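/- **Setting.** Let $d\ge 2$ and let $\Omega\subset\mathbb R^d$ be a bounded open polytopal set, partitioned into a finite set $\mathcal T_h$ of closed, possibly nonconvex, $d$-dimensional polytopes $T$ (polygons if $d=2$, polyhedra if $d=3$) with connected, pairwise disjoint interiors contained in $\Omega$ and with $\bigcup_{T}T=\overline\Omega$. Let $\mathcal E_h$ be the finite set of its edges/flat faces: closed flat $(d-1)$-dimensional polytopes with connected and pairwise disjoint relative interiors, such that every $e\in\mathcal E_h$ lies in the boundary of some $T$, $\partial T$ is the union of the $e\in\mathcal E_h$ with $e\subset\partial T$ (the faces of $T$), $T$ lies on one side of each of its faces, and every $e$ either lies in $\partial\Omega$ or has its relative interior in $\Omega$. Let $n_T$ be the number of faces of $T$, and $\mathbf n$ the outward unit normal on $\partial T$. For an integer $k\ge1$ let $$V_h=\{v=\{v_0,v_b\}:\ v_0|_T\in P_k(T)\ \ (T\in\mathcal T_h),\quad v_b|_e\in P_k(e)\ \ (e\in\mathcal E_h)\},\qquad V_h^0=\{v\in V_h:\ v_b|_e=0\ \text{ for } e\subset\partial\Omega\},$$ where $v_0$ may be discontinuous across faces and $v_b$ has one single value on each $e\in\mathcal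 E_h$. For $v\in V_h$ and a degree $j_T$, the weak gradient $\nabla_wv|_T\in[P_{j_T}(T)]^d$ is the unique polynomial vector field with $$(\nabla_w v,\mathbf q)_T=-(v_0,\nabla\cdot\mathbf q)_T+\langle v_b,\mathbf q\cdot\mathbf n\rangle_{\partial T}\qquad\forall\,\mathbf q\in[P_{j_T}(T)]^d .$$ **Lemma 3.2 (well-posedness).** Let $d\ge2$ and $k\ge1$. To every polytope $T$ with set of faces $F$ one can assign an integer $j_0(T,F)$, depending only on $k$, $T$ and $F$ (and not on the rest of the mesh), such that * if no two faces in $F$ lie in a common hyperplane, then $j_0(T,F)\le 2n_T+k-1$, and if moreover $T$ is convex, then $j_0(T,F)\le n_T+k-1$, where $n_T=|F|$; * for every $\Omega$, $\mathcal T_h$, $\mathcal E_h$ as above, all degrees $j_T\ge j_0(T,F_T)$ ($T\in\mathcal T_h$ with set of faces $F_T$), and every $f\in L^2(\Omega)$, the stabilizer-free weak Galerkin scheme $$\sum_{T\in\mathcal T_h}(\nabla_wu_h,\nabla_wv)_T=(f,v_0)\qquad\forall\,v=\{v_0,v_b\}\in V_h^0$$ has exactly one solution $u_h=\{u_0,u_b\}\in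 V_h^0$. In particular, $j_T=n_T+k-1$ may be taken on all convex elements $T$ whose faces lie in distinct hyperplanes, and on every polytopal mesh the scheme has a unique solution as soon as the degrees $j_T$ are large enough. -/

import Mathlib

open MeasureTheory Set Filter Topology

noncomputable section

namespace WG

/-- The Euclidean space `ℝ^d`. -/
abbrev Pt (d : ℕ) : Type := EuclideanSpace ℝ (Fin d)

variable {d : ℕ}

/-! ### Polytopal meshes -/

/-- A (not necessarily convex) polytopal set: a finite union of convex hulls of finite sets. -/
def IsPolytopal (S : Set (Pt d)) : Prop :=
  ∃ 𝒱 : Finset (Finset (Pt d)), S = ⋃ V ∈ 𝒱, convexHull ℝ (V : Set (Pt d))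

/-- A closed `d`-dimensional polytope (polygon, polyhedron, ...), possibly nonconvex. -/
structure IsElement (T : Set (Pt d)) : Prop where
  polytopal : IsPolytopal T
  regular : closure (interior T) = T
  connected : IsConnected (interior T)

/-- A flat `(d-1)`-dimensional closed polytope in `ℝ^d` (an edge if `d = 2`, a flat face
if `d = 3`), possibly nonconvex. -/
structure IsFlatFace (e : Set (Pt d)) : Prop where
  polytopal : IsPolytopal e
  finrank_eq : Module.finrank ℝ (vectorSpan ℝ e) = d - 1
  regular : closure (intrinsicInterior ℝ e) = e
  connected : IsConnected (intrinsicInterior ℝ e)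

/-- `n` is the unit normal of the face `e` of `T` that points out of `T`. -/
structure IsOutwardNormal (T e : Set (Pt d)) (n : Pt d) : Prop where
  norm_eq : ‖n‖ = 1
  orthogonal : ∀ x ∈ e, ∀ y ∈ e, inner ℝ n (x - y) = 0
  outward : ∀ x ∈ intrinsicInterior ℝ e, ∀ᶠ t : ℝ in 𝓝[>] 0,
    x - t • n ∈ interior T ∧ x + t • n ∉ T

/-- The outward unit normal of `T` on its face `e`. -/
def outwardNormal (T e : Set (Pt d)) : Pt d :=
  Classical.epsilon (IsOutwardNormal T e)

/-- A partition `𝒯_h` of `Ω` into finitely many polytopes, together with the set `ℰ_h` of all its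
edges or flat faces. The faces `e` of an element `T` are those with `e ⊆ ∂T`. -/
structure PolytopalMesh (Ω : Set (Pt d)) where
  /-- the elements `T ∈ 𝒯_h` -/
  elements : Finset (Set (Pt d))
  /-- the edges or flat faces `e ∈ ℰ_h` -/
  faces : Finset (Set (Pt d))
  isElement : ∀ T ∈ elements, IsElement T
  isFlatFace : ∀ e ∈ faces, IsFlatFace e
  interior_subset : ∀ T ∈ elements, interior T ⊆ Ω
  cover : ⋃ T ∈ elements, T = closure Ω
  disjoint_elements : ∀ T ∈ elements, ∀ T' ∈ elements, T ≠ T' →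
    Disjoint (interior T) (interior T')
  /-- every face is a face of some element -/
  exists_element : ∀ e ∈ faces, ∃ T ∈ elements, e ⊆ frontier T
  /-- the boundary of an element is the union of its faces -/
  frontier_eq : ∀ T ∈ elements, frontier T = ⋃₀ {e | e ∈ faces ∧ e ⊆ frontier T}
  disjoint_faces : ∀ e ∈ faces, ∀ e' ∈ faces, e ≠ e' →
    Disjoint (intrinsicInterior ℝ e) (intrinsicInterior ℝ e')
  /-- an element lies on one side of each of its faces -/
  exists_normal : ∀ T ∈ elements, ∀ e ∈ faces, e ⊆ frontier T → ∃ n, IsOutwardNormal T e n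
  /-- every face is either a boundary face or an interior face -/
  boundary_or_interior : ∀ e ∈ faces, e ⊆ frontier Ω ∨ intrinsicInterior ℝ e ⊆ Ω

open Classical in
/-- The faces of `T` in the mesh. -/
def PolytopalMesh.facesOf {Ω : Set (Pt d)} (M : PolytopalMesh Ω) (T : Set (Pt d)) :
    Finset (Set (Pt d)) :=
  {e ∈ M.faces | e ⊆ frontier T}

/-! ### Polynomials and integrals -/

/-- The value of a polynomial at a point. -/
def peval (p : MvPolynomial (Fin d) ℝ) (x : Pt d) : ℝ :=
  MvPolynomial.eval (fun i => x i) p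

/-- The divergence `∇ · q` of a polynomial vector field. -/
def pdiv (q : Fin d → MvPolynomial (Fin d) ℝ) : MvPolynomial (Fin d) ℝ :=
  ∑ i, MvPolynomial.pderiv i (q i)

/-- The restriction of polynomials to `S`, as a linear map. -/
def evalOn (S : Set (Pt d)) : MvPolynomial (Fin d) ℝ →ₗ[ℝ] (S → ℝ) where
  toFun p x := peval p x
  map_add' p q := by ext x; simp [peval]
  map_smul' c p := by ext x; simp [peval]

/-- `P_k(S)`: the functions on `S` that are restrictions of polynomials of total degree at
most `k`. -/
def polyOn (k : ℕ) (S : Set (Pt d)) : Submodule ℝ (S → ℝ) :=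
  (MvPolynomial.restrictTotalDegree (Fin d) ℝ k).map (evalOn S)

/-- The `d`-dimensional Lebesgue measure on an element. -/
def vol (T : Set (Pt d)) : Measure T :=
  (volume : Measure (Pt d)).comap Subtype.val

/-- The surface measure (`(d-1)`-dimensional Lebesgue measure) on a face. -/
def surface (e : Set (Pt d)) : Measure e :=
  (Measure.euclideanHausdorffMeasure (d - 1) : Measure (Pt d)).comap Subtype.val

/-! ### The weak Galerkin spaces -/

variable {Ω : Set (Pt d)}

/-- The weak Galerkin space `V_h`: pairs `v = {v₀, v_b}` where `v₀` is a polynomial of degree at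
most `k` on every element, and `v_b` is a polynomial of degree at most `k` on every face (one
single value on each face). -/
abbrev Vh (M : PolytopalMesh Ω) (k : ℕ) : Type :=
  ((T : M.elements) → polyOn k (T : Set (Pt d))) × ((e : M.faces) → polyOn k (e : Set (Pt d)))

/-- The subspace `V_h^0` of all `v` in `V_h` with `v_b = 0` on `∂Ω`. -/
def Vh0 (M : PolytopalMesh Ω) (k : ℕ) : Submodule ℝ (Vh M k) where
  carrier := {v | ∀ e : M.faces, (e : Set (Pt d)) ⊆ frontier Ω → v.2 e = 0}
  add_mem' := by
    intro v w hv hw e he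
    simp [hv e he, hw e he]
  zero_mem' := by
    intro e _
    rfl
  smul_mem' := by
    intro c v hv e he
    simp [hv e he]

/-! ### The weak gradient -/

open Classical in
/-- The right-hand side `-(v₀, ∇ · q)_T + ⟨v_b, q · n⟩_{∂T}` in the definition of the weak
gradient. -/
def weakGradRHS (M : PolytopalMesh Ω) {k : ℕ} (v : Vh M k) (T : M.elements)
    (q : Fin d → MvPolynomial (Fin d) ℝ) : ℝ :=
  -(∫ x, (v.1 T : _ → ℝ) x * peval (pdiv q) x ∂(vol (T : Set (Pt d)))) +
    ∑ e ∈ Finset.univ.filter (fun e : M.faces => (e : Set (Pt d)) ⊆ frontier (T : Set (Pt d))),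
      ∫ x,
        (v.2 e : _ → ℝ) x *
          ∑ i, peval (q i) x * outwardNormal (T : Set (Pt d)) (e : Set (Pt d)) i
        ∂(surface (e : Set (Pt d)))

/-- `G ∈ [P_j(T)]^d` is a weak gradient of `v` on `T`:
`(G, q)_T = -(v₀, ∇ · q)_T + ⟨v_b, q · n⟩_{∂T}` for all `q ∈ [P_j(T)]^d`. -/
def IsWeakGradient (M : PolytopalMesh Ω) {k : ℕ} (j : ℕ) (v : Vh M k) (T : M.elements)
    (G : Fin d → polyOn j (T : Set (Pt d))) : Prop :=
  ∀ q : Fin d → MvPolynomial (Fin d) ℝ,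
    (∀ i, q i ∈ MvPolynomial.restrictTotalDegree (Fin d) ℝ j) →
    ∑ i, ∫ x, (G i : _ → ℝ) x * peval (q i) x ∂(vol (T : Set (Pt d))) = weakGradRHS M v T q

theorem continuous_peval (p : MvPolynomial (Fin d) ℝ) : Continuous (peval (d := d) p) := by
  unfold peval
  exact (MvPolynomial.continuous_eval p).comp (by fun_prop)

theorem continuous_of_mem_polyOn {k : ℕ} {S : Set (Pt d)} {f : S → ℝ} (hf : f ∈ polyOn k S) :
    Continuous f := by
  obtain ⟨p, -, rfl⟩ := hf
  exact (continuous_peval p).comp continuous_subtype_val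

theorem IsPolytopal.isCompact {S : Set (Pt d)} (h : IsPolytopal S) : IsCompact S := by
  obtain ⟨𝒱, rfl⟩ := h
  exact 𝒱.isCompact_biUnion fun V _ => V.finite_toSet.isCompact_convexHull (𝕜 := ℝ)

theorem IsFlatFace.measure_lt_top {e : Set (Pt d)} (h : IsFlatFace e) :
    (Measure.euclideanHausdorffMeasure (d - 1) : Measure (Pt d)) e < ⊤ := by
  obtain ⟨p, hp'⟩ := h.connected.nonempty
  have hp : p ∈ e := intrinsicInterior_subset hp'
  let φ : vectorSpan ℝ e → Pt d := fun v => (v : Pt d) + p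
  have hφ : Isometry φ := (isometry_add_right p).comp isometry_subtype_coe
  have hsub : e ⊆ range φ := by
    intro x hx
    exact ⟨⟨x - p, vsub_mem_vectorSpan ℝ hx hp⟩, by simp [φ]⟩
  have h1 := hφ.euclideanHausdorffMeasure_preimage (d := d - 1) e
  rw [inter_eq_self_of_subset_left hsub] at h1
  rw [← h1, ← h.finrank_eq]
  have hc : IsCompact (φ ⁻¹' e) :=
    hφ.isClosedEmbedding.isCompact_preimage h.polytopal.isCompact
  exact hc.measure_lt_top

theorem isFiniteMeasure_surface {e : Set (Pt d)} (h : IsFlatFace e) :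
    IsFiniteMeasure (surface e) := by
  refine ⟨?_⟩
  unfold surface
  rw [(MeasurableEmbedding.subtype_coe h.polytopal.isCompact.measurableSet).comap_apply]
  simpa using h.measure_lt_top

theorem integrable_of_continuous {S : Set (Pt d)} (hS : IsCompact S) (μ : Measure S)
    [IsFiniteMeasure μ] {f : S → ℝ} (hf : Continuous f) : Integrable f μ := by
  have := isCompact_iff_compactSpace.mp hS
  exact (integrableOn_univ).1 (hf.continuousOn.integrableOn_compact isCompact_univ)

theorem isFiniteMeasure_vol {S : Set (Pt d)} (hS : IsCompact S) :
    IsFiniteMeasure (vol S) := by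
  refine ⟨?_⟩
  unfold vol
  rw [(MeasurableEmbedding.subtype_coe hS.measurableSet).comap_apply]
  simpa using hS.measure_lt_top

theorem weakGradRHS_add (M : PolytopalMesh Ω) {k : ℕ} (v : Vh M k) (T : M.elements)
    (q r : Fin d → MvPolynomial (Fin d) ℝ) :
    weakGradRHS M v T (q + r) = weakGradRHS M v T q + weakGradRHS M v T r := by
  have hT := (M.isElement T T.2).polytopal.isCompact
  have := isFiniteMeasure_vol hT
  have hv := continuous_of_mem_polyOn (v.1 T).2
  have hc : ∀ p : MvPolynomial (Fin d) ℝ, Continuous fun x : (T : Set (Pt d)) => peval p x :=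
    fun p => (continuous_peval p).comp continuous_subtype_val
  have hI : ∀ p : MvPolynomial (Fin d) ℝ, Integrable
      (fun x : (T : Set (Pt d)) => (v.1 T : _ → ℝ) x * peval p x) (vol (T : Set (Pt d))) :=
    fun p => integrable_of_continuous hT _ (hv.mul (hc p))
  have h1 : ∫ x, (v.1 T : _ → ℝ) x * peval (pdiv (q + r)) x ∂(vol (T : Set (Pt d))) =
      (∫ x, (v.1 T : _ → ℝ) x * peval (pdiv q) x ∂(vol (T : Set (Pt d)))) +
      ∫ x, (v.1 T : _ → ℝ) x * peval (pdiv r) x ∂(vol (T : Set (Pt d))) := by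
    rw [← integral_add (hI _) (hI _)]
    congr 1
    ext x
    simp [pdiv, peval, Finset.sum_add_distrib, mul_add]
  unfold weakGradRHS
  rw [h1, neg_add, add_add_add_comm, ← Finset.sum_add_distrib]
  congr 1
  refine Finset.sum_congr rfl fun e _ => ?_
  have he := M.isFlatFace e e.2
  have := isFiniteMeasure_surface he
  have hw := continuous_of_mem_polyOn (v.2 e).2
  have hc' : ∀ s : Fin d → MvPolynomial (Fin d) ℝ, Continuous fun x : (e : Set (Pt d)) =>
      (v.2 e : _ → ℝ) x *
        ∑ i, peval (s i) x * outwardNormal (T : Set (Pt d)) (e : Set (Pt d)) i := fun s =>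
    hw.mul (continuous_finsetSum _ fun i _ =>
      ((continuous_peval (s i)).comp continuous_subtype_val).mul continuous_const)
  rw [← integral_add (integrable_of_continuous he.polytopal.isCompact _ (hc' q))
      (integrable_of_continuous he.polytopal.isCompact _ (hc' r))]
  congr 1
  ext x
  simp [peval, add_mul, Finset.sum_add_distrib, mul_add]

theorem weakGradRHS_smul (M : PolytopalMesh Ω) {k : ℕ} (v : Vh M k) (T : M.elements)
    (c : ℝ) (q : Fin d → MvPolynomial (Fin d) ℝ) :
    weakGradRHS M v T (c • q) = c * weakGradRHS M v T q := by
  unfold weakGradRHS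
  rw [mul_add, Finset.mul_sum, mul_neg, ← integral_const_mul]
  congr 1
  · congr 2
    ext x
    simp [pdiv, peval, Finset.mul_sum, mul_left_comm]
  · refine Finset.sum_congr rfl fun e _ => ?_
    rw [← integral_const_mul]
    congr 1
    ext x
    simp [peval, Finset.mul_sum, mul_left_comm, mul_assoc]

theorem eq_zero_of_integral_sq {T : Set (Pt d)} (hT : IsElement T)
    (p : Fin d → MvPolynomial (Fin d) ℝ)
    (h : ∑ i, ∫ x, peval (p i) x * peval (p i) x ∂(vol T) = 0) (i : Fin d) : evalOn T (p i) = 0 := by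
  have hc := hT.polytopal.isCompact
  have := isFiniteMeasure_vol hc
  have hi := (Finset.sum_eq_zero_iff_of_nonneg (fun i _ =>
    integral_nonneg fun x : T => mul_self_nonneg (peval (p i) x))).1 h i (Finset.mem_univ i)
  have hm : MeasurableSet T := hc.measurableSet
  unfold vol at hi
  rw [integral_subtype_comap hm (fun x => peval (p i) x * peval (p i) x)] at hi
  have hcont := continuous_peval (p i)
  have hae := (setIntegral_eq_zero_iff_of_nonneg_ae
    (Eventually.of_forall fun x => mul_self_nonneg (peval (p i) x))
    ((hcont.mul hcont).continuousOn.integrableOn_compact hc)).1 hi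
  have hae' : ∀ᵐ x ∂(volume.restrict (interior T)), peval (p i) x * peval (p i) x = 0 :=
    ae_mono (Measure.restrict_mono interior_subset le_rfl) hae
  have heq : EqOn (fun x => peval (p i) x * peval (p i) x) (fun _ => (0 : ℝ)) (interior T) :=
    Measure.eqOn_open_of_ae_eq hae' isOpen_interior (hcont.mul hcont).continuousOn
      continuousOn_const
  have hcl := heq.closure (hcont.mul hcont) continuous_const
  rw [hT.regular] at hcl
  ext x
  simpa [evalOn] using hcl x.2

theorem evalOn_injective {T : Set (Pt d)} (hT : IsElement T) :
    Function.Injective (evalOn T) := by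
  refine (injective_iff_map_eq_zero _).2 fun p hp => ?_
  obtain ⟨x₀, hx₀⟩ := hT.connected.nonempty
  have ho : IsOpen ((fun y : Fin d → ℝ => (WithLp.toLp 2 y : Pt d)) ⁻¹' interior T) :=
    isOpen_interior.preimage (by fun_prop)
  obtain ⟨ε, hε, hb⟩ := Metric.isOpen_iff.1 ho (fun i => x₀ i) (by simpa using hx₀)
  rw [ball_pi _ hε] at hb
  refine MvPolynomial.funext_set (fun i => Metric.ball (x₀ i) ε) (fun i => ?_) fun y hy => ?_
  · rw [Real.ball_eq_Ioo]
    exact Ioo_infinite (by linarith)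
  · have := congrFun hp ⟨WithLp.toLp 2 y, interior_subset (hb hy)⟩
    simpa [evalOn, peval] using this

/-- The weak gradient exists and is unique. -/
theorem existsUnique_isWeakGradient (M : PolytopalMesh Ω) {k : ℕ} (j : ℕ) (v : Vh M k)
    (T : M.elements) : ∃! G, IsWeakGradient M j v T G := by
  have hT := M.isElement T T.2
  have hc := hT.polytopal.isCompact
  have := isFiniteMeasure_vol hc
  let P := MvPolynomial.restrictTotalDegree (Fin d) ℝ j
  have hcont : ∀ p : MvPolynomial (Fin d) ℝ, Continuous fun x : (T : Set (Pt d)) => peval p x :=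
    fun p => (continuous_peval p).comp continuous_subtype_val
  have hint : ∀ p q : MvPolynomial (Fin d) ℝ,
      Integrable (fun x : (T : Set (Pt d)) => peval p x * peval q x) (vol (T : Set (Pt d))) := fun p q =>
    integrable_of_continuous hc _ ((hcont p).mul (hcont q))
  let B : (Fin d → P) →ₗ[ℝ] (Fin d → P) →ₗ[ℝ] ℝ := LinearMap.mk₂ ℝ
    (fun p q => ∑ i, ∫ x,
      peval (p i : MvPolynomial (Fin d) ℝ) x * peval (q i : MvPolynomial (Fin d) ℝ) x
        ∂(vol (T : Set (Pt d))))
    (fun p p' q => by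
      rw [← Finset.sum_add_distrib]
      refine Finset.sum_congr rfl fun i _ => ?_
      rw [← integral_add (hint _ _) (hint _ _)]
      congr 1; ext x; simp [peval, add_mul])
    (fun c p q => by
      rw [smul_eq_mul, Finset.mul_sum]
      refine Finset.sum_congr rfl fun i _ => ?_
      rw [← integral_const_mul]
      congr 1; ext x; simp [peval, mul_assoc])
    (fun p q q' => by
      rw [← Finset.sum_add_distrib]
      refine Finset.sum_congr rfl fun i _ => ?_
      rw [← integral_add (hint _ _) (hint _ _)]
      congr 1; ext x; simp [peval, mul_add])
    (fun c p q => by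
      rw [smul_eq_mul, Finset.mul_sum]
      refine Finset.sum_congr rfl fun i _ => ?_
      rw [← integral_const_mul]
      congr 1; ext x; simp [peval, mul_left_comm])
  let L : (Fin d → P) →ₗ[ℝ] ℝ :=
    { toFun := fun q => weakGradRHS M v T fun i => (q i : MvPolynomial (Fin d) ℝ)
      map_add' := fun q r => weakGradRHS_add M v T _ _
      map_smul' := fun c q => weakGradRHS_smul M v T c _ }
  have hinj : Function.Injective B := by
    refine (injective_iff_map_eq_zero _).2 fun p hp => ?_
    have h0 : B p p = 0 := by rw [hp]; rfl
    ext1 i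
    have h1 := eq_zero_of_integral_sq hT (fun i => (p i : MvPolynomial (Fin d) ℝ)) h0 i
    exact Subtype.ext ((injective_iff_map_eq_zero _).1 (evalOn_injective hT) _ h1)
  have hsurj : Function.Surjective B :=
    (LinearMap.injective_iff_surjective_of_finrank_eq_finrank
      (Subspace.dual_finrank_eq (K := ℝ) (V := Fin d → P)).symm).1 hinj
  obtain ⟨p, hp⟩ := hsurj L
  refine ⟨fun i => ⟨evalOn _ (p i : MvPolynomial (Fin d) ℝ), _, (p i).2, rfl⟩, ?_, ?_⟩
  · intro q hq
    exact LinearMap.congr_fun hp (fun i => ⟨q i, hq i⟩)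
  · intro G hG
    choose g hg hgG using fun i => (G i).2
    have hBG : B (fun i => ⟨g i, hg i⟩) = B p := by
      rw [hp]
      refine LinearMap.ext fun q => ?_
      have := hG (fun i => q i) (fun i => (q i).2)
      simp only [← hgG] at this
      exact this
    have hgp := hinj hBG
    ext1 i
    apply Subtype.ext
    rw [← hgG i]
    exact congrArg (fun s : Fin d → P => evalOn (T : Set (Pt d)) (s i : MvPolynomial _ ℝ)) hgp

/-- The weak gradient `∇_w v ∈ [P_j(T)]^d` of `v` on `T`. -/
def weakGrad (M : PolytopalMesh Ω) {k : ℕ} (j : ℕ) (v : Vh M k) (T : M.elements) :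
    Fin d → polyOn j (T : Set (Pt d)) :=
  (existsUnique_isWeakGradient M j v T).choose

/-! ### The stabilizer-free weak Galerkin scheme -/

/-- The form `(∇_w u, ∇_w v)_{𝒯_h}`; on the element `T` the weak gradients have degree `j T`. -/
def wgForm (M : PolytopalMesh Ω) {k : ℕ} (j : Set (Pt d) → ℕ) (u v : Vh M k) : ℝ :=
  ∑ T : M.elements, ∫ x,
    ∑ i, (weakGrad M (j T) u T i : _ → ℝ) x * (weakGrad M (j T) v T i : _ → ℝ) x
    ∂(vol (T : Set (Pt d)))

/-- The load `(f, v₀) = ∑_T ∫_T f v₀`. -/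
def wgLoad (M : PolytopalMesh Ω) {k : ℕ} (f : Pt d → ℝ) (v : Vh M k) : ℝ :=
  ∑ T : M.elements, ∫ x, f x * (v.1 T : _ → ℝ) x ∂(vol (T : Set (Pt d)))

/-- `u ∈ V_h^0` solves the stabilizer-free weak Galerkin scheme:
`(∇_w u, ∇_w v)_{𝒯_h} = (f, v₀)` for all `v = {v₀, v_b} ∈ V_h^0`. -/
def IsWGSolution (M : PolytopalMesh Ω) {k : ℕ} (j : Set (Pt d) → ℕ) (f : Pt d → ℝ)
    (u : Vh M k) : Prop :=
  u ∈ Vh0 M k ∧ ∀ v ∈ Vh0 M k, wgForm M j u v = wgLoad M f v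

/-- No two faces in `F` lie in a common hyperplane. For the faces of a convex polytope this says
that they are exactly its facets. -/
def NoCoplanarFaces (F : Finset (Set (Pt d))) : Prop :=
  ∀ e ∈ F, ∀ e' ∈ F, e ≠ e' → affineSpan ℝ e ≠ affineSpan ℝ e'

end WG

end

open MeasureTheory Set Filter Topology

noncomputable section

namespace WG

variable {d : ℕ}

/-! Solutions and test functions range over the same finite-dimensional space, so existence and
uniqueness both follow once `wgForm M j v v = 0` forces `v = 0` on `V_h^0`
(`existsUnique_of_definite`, `eq_zero_of_wgForm`). If the weak gradient of `v` vanishes, Green's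
formula (`IsCell.green`) gives `(∇v₀, q)_T + ⟨v_b - v₀, q · n⟩_{∂T} = 0` for all polynomial fields
`q` of degree at most `j_T`, and everything rests on good choices of `q`.

Each face has an affine form `ℓ_e` whose zero set is the hyperplane of `e`, and which is nonnegative
on `T` if `T` is convex. Let `ω = ∏ ℓ_e ^ r` with `r = 1` in the convex case and `r = 2` otherwise.
Then `ω ≥ 0` on `T` and `ω = 0` on `∂T`, so `q = ω ∇v₀`, of degree at most `r n_T + k - 1`, yields
`∇v₀ = 0`. If the factor of one face `e` is left out of `ω`, then `q = ω (v_b - v₀) n_e` sees the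
face `e` only and yields `v_b = v₀` there, as long as no other face is coplanar with `e`; its degree
is at most `r (n_T - 1) + k`, which is no larger.

With coplanar faces there is no explicit degree. If the identity holds for all polynomial `q`,
Weierstrass approximation allows continuous test functions concentrated near one point of `e`, so
again `v_b = v₀`. The kernels for growing degree form a decreasing chain of subspaces of a
finite-dimensional space, so some finite degree already has the smallest kernel.

Hence `v` is a constant `c_T` on each element and on its faces. Along a generic line `∑ c_T 1_T`
does not jump: at an interior face the adjacent elements carry the same constant, and at a boundary
face it is zero. As the sum vanishes far out, it is zero (`PolytopalMesh.eq_zero_of_constant`). No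
connectedness of `Ω` enters.

The divergence theorem on nonconvex polytopes comes from the same jump calculus: for a direction
`u`, almost everywhere `1_T` is the sum of `sign (n_e · u)` times the indicator of the shadow that
`e` casts along `u`, and on a single shadow Fubini and the fundamental theorem of calculus suffice.
-/

/-! ### Skew coordinates with respect to a hyperplane -/

/-- The map `(w, t) ↦ p + w + t u` from `W × ℝ`. -/
def skew (W : Submodule ℝ (Pt d)) (p u : Pt d) (x : W × ℝ) : Pt d := p + (x.1 : Pt d) + x.2 • u

theorem continuous_skew (W : Submodule ℝ (Pt d)) (p u : Pt d) : Continuous (skew W p u) := by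
  unfold skew
  fun_prop

/-- The map `W × ℝ → ℝ^d` is volume preserving for a unit normal of the hyperplane `W`. -/
theorem measurePreserving_normal (W : Submodule ℝ (Pt d)) (hd : 1 ≤ d)
    (hW : Module.finrank ℝ W = d - 1)
    (n : Pt d) (hn : ‖n‖ = 1) (hort : ∀ w ∈ W, inner ℝ n w = 0) :
    MeasurePreserving (fun x : W × ℝ => (x.1 : Pt d) + x.2 • n) := by
  let l : WithLp 2 (W × ℝ) →ₗ[ℝ] Pt d :=
    { toFun := fun x => (x.fst : Pt d) + x.snd • n
      map_add' := by intro x y; simp [add_smul]; abel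
      map_smul' := by intro c x; simp [smul_smul] }
  let L : WithLp 2 (W × ℝ) →ₗᵢ[ℝ] Pt d :=
    { toLinearMap := l
      norm_map' := by
        intro x
        have h1 : inner ℝ (x.fst : Pt d) (x.snd • n) = 0 := by
          rw [real_inner_comm, inner_smul_left, hort _ x.fst.2, mul_zero]
        have h2 := norm_add_sq_eq_norm_sq_add_norm_sq_of_inner_eq_zero _ _ h1
        have h3 := WithLp.prod_norm_sq_eq_of_L2 x
        change ‖(x.fst : Pt d) + x.snd • n‖ = ‖x‖
        rw [norm_smul, hn, mul_one] at h2
        rw [← abs_of_nonneg (norm_nonneg x), ← abs_of_nonneg (norm_nonneg (_ + _)), ← sq_eq_sq_iff_abs_eq_abs]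
        rw [h3, sq, h2]
        simp [sq] }
  have hfr : Module.finrank ℝ (WithLp 2 (W × ℝ)) = Module.finrank ℝ (Pt d) := by
    rw [(WithLp.linearEquiv 2 ℝ (W × ℝ)).finrank_eq, Module.finrank_prod, hW]
    simp
    omega
  have h1 := (L.toLinearIsometryEquiv hfr).measurePreserving
  have h2 := h1.comp (WithLp.volume_preserving_toLp (U := W) (V := ℝ))
  exact h2

/-- The map is the orthonormal parametrization followed by the transvection that fixes `W` and sends
`n` to `u`, and then a translation. Only the transvection changes volume, by the factor `1 + ⟨n, u -
n⟩ = ⟨n, u⟩`. -/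
theorem map_skew (W : Submodule ℝ (Pt d)) (hd : 1 ≤ d) (hW : Module.finrank ℝ W = d - 1)
    (n : Pt d) (hn : ‖n‖ = 1) (hort : ∀ w ∈ W, inner ℝ n w = 0) (p u : Pt d)
    (hu : inner ℝ n u ≠ (0 : ℝ)) :
    Measure.map (skew W p u) volume = ENNReal.ofReal |(inner ℝ n u : ℝ)⁻¹| • volume := by
  have h0 := measurePreserving_normal W hd hW n hn hort
  let A : Pt d →ₗ[ℝ] Pt d := LinearMap.transvection (innerₛₗ ℝ n) (u - n)
  have hdet : LinearMap.det A = inner ℝ n u := by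
    rw [LinearMap.transvection.det]
    simp [inner_sub_right, hn]
  have hA := Measure.map_linearMap_addHaar_eq_smul_addHaar (volume : Measure (Pt d))
    (f := A) (by rw [hdet]; exact hu)
  have hcA : Continuous A := A.continuous_of_finiteDimensional
  have hcomp : skew W p u = (fun x => p + x) ∘ A ∘ fun x : W × ℝ => (x.1 : Pt d) + x.2 • n := by
    ext1 x
    have : inner ℝ n ((x.1 : Pt d) + x.2 • n) = x.2 := by
      rw [inner_add_right, hort _ x.1.2, inner_smul_right, real_inner_self_eq_norm_sq, hn]; simp
    simp only [skew, Function.comp, A, LinearMap.transvection.apply, innerₛₗ_apply_apply, this,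
      smul_sub]
    abel
  rw [hcomp, ← Measure.map_map (by fun_prop) (hcA.measurable.comp h0.measurable),
    ← Measure.map_map hcA.measurable h0.measurable, h0.map_eq, hA, Measure.map_smul, hdet,
    (measurePreserving_add_left (volume : Measure (Pt d)) p).map_eq]

theorem measurableEmbedding_skew (W : Submodule ℝ (Pt d)) (n : Pt d)
    (hort : ∀ w ∈ W, inner ℝ n w = 0) (p u : Pt d) (hu : inner ℝ n u ≠ (0 : ℝ)) :
    MeasurableEmbedding (skew W p u) := by
  refine (continuous_skew W p u).measurableEmbedding ?_
  rintro ⟨w, t⟩ ⟨w', t'⟩ h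
  simp only [skew] at h
  have h1 := congrArg (fun y => inner ℝ n (y - p)) h
  simp only [add_assoc, add_sub_cancel_left, inner_add_right, inner_smul_right, hort _ w.2, hort _ w'.2,
    zero_add] at h1
  have h2 : t = t' := mul_right_cancel₀ hu h1
  subst h2
  simpa using h

theorem integral_skew (W : Submodule ℝ (Pt d)) (hd : 1 ≤ d) (hW : Module.finrank ℝ W = d - 1)
    (n : Pt d) (hn : ‖n‖ = 1) (hort : ∀ w ∈ W, inner ℝ n w = 0) (p u : Pt d)
    (hu : inner ℝ n u ≠ (0 : ℝ)) (g : Pt d → ℝ) :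
    ∫ x, g x = |(inner ℝ n u : ℝ)| * ∫ y, g (skew W p u y) := by
  have h := (measurableEmbedding_skew W n hort p u hu).integral_map (μ := volume) g
  rw [map_skew W hd hW n hn hort p u hu, integral_smul_measure, ENNReal.toReal_ofReal (abs_nonneg _),
    abs_inv, smul_eq_mul] at h
  rw [← h, mul_inv_cancel_left₀ (abs_ne_zero.2 hu)]

theorem integrable_comp_skew (W : Submodule ℝ (Pt d)) (hd : 1 ≤ d)
    (hW : Module.finrank ℝ W = d - 1)
    (n : Pt d) (hn : ‖n‖ = 1) (hort : ∀ w ∈ W, inner ℝ n w = 0) (p u : Pt d)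
    (hu : inner ℝ n u ≠ (0 : ℝ)) {g : Pt d → ℝ} (hg : Integrable g) :
    Integrable (fun y => g (skew W p u y)) := by
  have h := (measurableEmbedding_skew W n hort p u hu).integrable_map_iff (μ := volume) (g := g)
  rw [map_skew W hd hW n hn hort p u hu] at h
  exact h.1 (hg.smul_measure ENNReal.ofReal_ne_top)

/-- A measurable embedding computes the push-forward on every set. This matters because the
exceptional sets of lines below come with no measurability. -/
theorem null_of_preimage_skew (W : Submodule ℝ (Pt d)) (hd : 1 ≤ d)
    (hW : Module.finrank ℝ W = d - 1)
    (n : Pt d) (hn : ‖n‖ = 1) (hort : ∀ w ∈ W, inner ℝ n w = 0) (p u : Pt d)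
    (hu : inner ℝ n u ≠ (0 : ℝ)) {N : Set (Pt d)} (hN : volume (skew W p u ⁻¹' N) = 0) :
    volume N = 0 := by
  have h := (measurableEmbedding_skew W n hort p u hu).map_apply volume N
  rw [map_skew W hd hW n hn hort p u hu, hN, Measure.smul_apply, smul_eq_mul, mul_eq_zero] at h
  refine h.resolve_left ?_
  simpa using hu

/-! ### The chart of a flat face -/

/-- The isometric parametrization `w ↦ w + p` of the affine hull of `e ∋ p`. -/
def chart (e : Set (Pt d)) (p : Pt d) (w : vectorSpan ℝ e) : Pt d := p + (w : Pt d)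

theorem isometry_chart (e : Set (Pt d)) (p : Pt d) : Isometry (chart e p) :=
  (isometry_add_left p).comp isometry_subtype_coe

theorem continuous_chart (e : Set (Pt d)) (p : Pt d) : Continuous (chart e p) :=
  (isometry_chart e p).continuous

theorem mem_range_chart {e : Set (Pt d)} {p x : Pt d} (hp : p ∈ e) (hx : x ∈ e) :
    ∃ w, chart e p w = x :=
  ⟨⟨x - p, vsub_mem_vectorSpan ℝ hx hp⟩, by simp [chart]⟩

theorem IsFlatFace.isCompact {e : Set (Pt d)} (h : IsFlatFace e) : IsCompact e :=
  h.polytopal.isCompact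

/-- An isometry preserves Hausdorff measure, which in the right dimension is Lebesgue measure on the
direction space. Surface integrals thus become Lebesgue integrals, to which Fubini applies. -/
theorem IsFlatFace.map_chart {e : Set (Pt d)} (h : IsFlatFace e) {p : Pt d} (hp : p ∈ e) :
    Measure.map (chart e p) (volume.restrict (chart e p ⁻¹' e)) =
      (Measure.euclideanHausdorffMeasure (d - 1) : Measure (Pt d)).restrict e := by
  have h1 := (isometry_chart e p).map_euclideanHausdorffMeasure (d := d - 1)
  have h2 : (Measure.euclideanHausdorffMeasure (d - 1) : Measure (vectorSpan ℝ e)) = volume := by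
    rw [← h.finrank_eq]
    exact InnerProductSpace.euclideanHausdorffMeasure_eq_volume
  rw [h2] at h1
  rw [← Measure.restrict_map (continuous_chart e p).measurable h.isCompact.measurableSet, h1,
    Measure.restrict_restrict h.isCompact.measurableSet, inter_eq_self_of_subset_left]
  intro x hx
  exact mem_range_chart hp hx

theorem IsFlatFace.integral_surface {e : Set (Pt d)} (h : IsFlatFace e) {p : Pt d} (hp : p ∈ e)
    (g : Pt d → ℝ) :
    ∫ x : e, g x ∂(surface e) = ∫ w in chart e p ⁻¹' e, g (chart e p w) := by
  unfold surface
  rw [integral_subtype_comap h.isCompact.measurableSet g, ← h.map_chart hp,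
    (isometry_chart e p).isClosedEmbedding.measurableEmbedding.integral_map]

/-- The parametrization of the affine hull of `e` as an affine isometry. -/
def chartIsometry (e : Set (Pt d)) (p : Pt d) : vectorSpan ℝ e →ᵃⁱ[ℝ] Pt d :=
  (AffineIsometryEquiv.constVAdd ℝ (Pt d) p).toAffineIsometry.comp
    (vectorSpan ℝ e).subtypeₗᵢ.toAffineIsometry

theorem coe_chartIsometry (e : Set (Pt d)) (p : Pt d) : ⇑(chartIsometry e p) = chart e p := by
  ext1 w
  simp [chartIsometry, chart]

theorem chart_image_preimage {e : Set (Pt d)} {p : Pt d} (hp : p ∈ e) :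
    chart e p '' (chart e p ⁻¹' e) = e := by
  rw [image_preimage_eq_inter_range, inter_eq_self_of_subset_left]
  exact fun x hx => mem_range_chart hp hx

/-- In its chart a face is full-dimensional, so its intrinsic interior becomes an ordinary interior.
-/
theorem affineSpan_preimage_chart {e : Set (Pt d)} {p : Pt d} (hp : p ∈ e) :
    affineSpan ℝ (chart e p ⁻¹' e) = ⊤ := by
  have hne : (chart e p ⁻¹' e).Nonempty := ⟨0, by simpa [chart] using hp⟩
  rw [AffineSubspace.affineSpan_eq_top_iff_vectorSpan_eq_top_of_nonempty ℝ _ _ hne]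
  have h1 := AffineMap.map_vectorSpan (k := ℝ)
    (chartIsometry e p).toAffineMap (s := chart e p ⁻¹' e)
  have h2 : (chartIsometry e p).toAffineMap '' (chart e p ⁻¹' e) = e := by
    change ⇑(chartIsometry e p) '' _ = e
    rw [coe_chartIsometry, chart_image_preimage hp]
  have h3 : (chartIsometry e p).toAffineMap.linear = (vectorSpan ℝ e).subtype := by
    refine LinearMap.ext fun w => ?_
    change ((AffineIsometryEquiv.constVAdd ℝ (Pt d) p).toAffineIsometry.comp
      (vectorSpan ℝ e).subtypeₗᵢ.toAffineIsometry).linearIsometry w = _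
    rfl
  rw [h2, h3] at h1
  apply Submodule.map_injective_of_injective (vectorSpan ℝ e).injective_subtype
  rw [h1, Submodule.map_subtype_top]

theorem intrinsicInterior_eq_interior {E : Type*} [NormedAddCommGroup E] [NormedSpace ℝ E]
    {s : Set E} (hs : affineSpan ℝ s = ⊤) : intrinsicInterior ℝ s = interior s := by
  refine subset_antisymm ?_ interior_subset_intrinsicInterior
  rintro x ⟨y, hy, rfl⟩
  have ho : IsOpen ((affineSpan ℝ s : AffineSubspace ℝ E) : Set E) := by rw [hs]; exact isOpen_univ
  have h1 := ho.isOpenMap_subtype_val _ (isOpen_interior (s := ((↑) : affineSpan ℝ s → E) ⁻¹' s))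
  refine (interior_maximal ?_ h1) ⟨y, hy, rfl⟩
  rintro _ ⟨z, hz, rfl⟩
  exact interior_subset (s := ((↑) : affineSpan ℝ s → E) ⁻¹' s) hz

theorem chart_mem_intrinsicInterior_iff {e : Set (Pt d)} {p : Pt d} (hp : p ∈ e)
    (w : vectorSpan ℝ e) :
    chart e p w ∈ intrinsicInterior ℝ e ↔ w ∈ interior (chart e p ⁻¹' e) := by
  have h1 := AffineIsometry.intrinsicInterior_image (chartIsometry e p) (chart e p ⁻¹' e)
  rw [coe_chartIsometry, chart_image_preimage hp,
    intrinsicInterior_eq_interior (affineSpan_preimage_chart hp)] at h1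
  rw [h1, (isometry_chart e p).injective.mem_set_image]

/-- A face is a finite union of convex sets, its relative boundary lies in the union of their
frontiers, and the frontier of a convex set is null. -/
theorem IsFlatFace.null_boundary {e : Set (Pt d)} (h : IsFlatFace e) {p : Pt d} (hp : p ∈ e) :
    volume (chart e p ⁻¹' (e \ intrinsicInterior ℝ e)) = 0 := by
  obtain ⟨𝒱, h𝒱⟩ := h.polytopal
  have hconv : ∀ V : Finset (Pt d), Convex ℝ (chart e p ⁻¹' convexHull ℝ (V : Set (Pt d))) := by
    intro V
    exact ((convex_convexHull ℝ (V : Set (Pt d))).translate_preimage_right p).linear_preimage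
      (vectorSpan ℝ e).subtype
  have hsub : chart e p ⁻¹' (e \ intrinsicInterior ℝ e) ⊆
      ⋃ V ∈ 𝒱, frontier (chart e p ⁻¹' convexHull ℝ (V : Set (Pt d))) := by
    rintro w ⟨hw, hw'⟩
    rw [chart_mem_intrinsicInterior_iff hp] at hw'
    have hw2 : chart e p w ∈ ⋃ V ∈ 𝒱, convexHull ℝ (V : Set (Pt d)) := h𝒱 ▸ hw
    obtain ⟨V, hV, hwV⟩ := mem_iUnion₂.1 hw2
    refine mem_iUnion₂.2 ⟨V, hV, subset_closure hwV, fun hi => hw' (interior_mono ?_ hi)⟩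
    refine preimage_mono fun x hx => ?_
    rw [h𝒱]
    exact mem_biUnion hV hx
  refine measure_mono_null hsub ((measure_biUnion_null_iff 𝒱.countable_toSet).2 ?_)
  exact fun V _ => (hconv V).addHaar_frontier volume

/-- The part of a face in a different hyperplane has surface measure zero. -/
theorem IsFlatFace.null_inter_affineSpan {e e' : Set (Pt d)} (h : IsFlatFace e) (h' : IsFlatFace e')
    (hne : affineSpan ℝ e ≠ affineSpan ℝ e') {p : Pt d} (hp : p ∈ e) :
    volume (chart e p ⁻¹' (affineSpan ℝ e' : Set (Pt d))) = 0 := by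
  have h1 : chart e p ⁻¹' (affineSpan ℝ e' : Set (Pt d)) =
      ((affineSpan ℝ e').comap (chartIsometry e p).toAffineMap : Set (vectorSpan ℝ e)) := by
    rw [AffineSubspace.coe_comap]
    change _ = ⇑(chartIsometry e p) ⁻¹' _
    rw [coe_chartIsometry]
  rw [h1]
  -- A proper affine subspace is null. If this one were everything, the hull of `e` would lie in
  -- that of `e'`, and equal dimensions would make them coincide.
  refine Measure.addHaar_affineSubspace _ _ fun htop => hne ?_
  rw [htop] at h1
  have hsub : e ⊆ affineSpan ℝ e' := by
    intro x hx
    obtain ⟨w, rfl⟩ := mem_range_chart hp hx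
    exact (h1 ▸ trivial : w ∈ chart e p ⁻¹' (affineSpan ℝ e' : Set (Pt d)))
  have hle : affineSpan ℝ e ≤ affineSpan ℝ e' := affineSpan_le.2 hsub
  refine AffineSubspace.eq_of_direction_eq_of_nonempty_of_le ?_ ?_ hle
  · refine Submodule.eq_of_le_of_finrank_eq (AffineSubspace.direction_le hle) ?_
    rw [direction_affineSpan, direction_affineSpan, h.finrank_eq, h'.finrank_eq]
  · exact ⟨p, subset_affineSpan ℝ e hp⟩

/-- Two different faces of a mesh meet in a set of surface measure zero. -/
theorem IsFlatFace.null_inter {e e' : Set (Pt d)} (h : IsFlatFace e) (h' : IsFlatFace e')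
    (hdis : Disjoint (intrinsicInterior ℝ e) (intrinsicInterior ℝ e')) {p : Pt d} (hp : p ∈ e) :
    volume (chart e p ⁻¹' (e ∩ e')) = 0 := by
  by_cases hne : affineSpan ℝ e = affineSpan ℝ e'
  -- In the coplanar case a point of `e'` in the relative interior of `e` is a limit of relative
  -- interior points of `e'`. These lie in the common hyperplane, hence eventually in the relative
  -- interior of `e`, against disjointness.
  · suffices hsub : e ∩ e' ⊆ e \ intrinsicInterior ℝ e from
      measure_mono_null (preimage_mono hsub) (h.null_boundary hp)
    refine fun x hx => ⟨hx.1, fun hi => ?_⟩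
    obtain ⟨w, rfl⟩ := mem_range_chart hp hx.1
    obtain ⟨ε, hε, hb⟩ := Metric.isOpen_iff.1 isOpen_interior w
      ((chart_mem_intrinsicInterior_iff hp w).1 hi)
    have hcl : chart e p w ∈ closure (intrinsicInterior ℝ e') := by
      rw [h'.regular]; exact hx.2
    obtain ⟨y, hy, hdist⟩ := Metric.mem_closure_iff.1 hcl ε hε
    have hyW : y - p ∈ vectorSpan ℝ e := by
      rw [← direction_affineSpan]
      refine AffineSubspace.vsub_mem_direction ?_ (subset_affineSpan ℝ e hp)
      rw [hne]
      exact subset_affineSpan ℝ e' (intrinsicInterior_subset hy)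
    have hy' : chart e p ⟨y - p, hyW⟩ = y := by simp [chart]
    rw [← hy', (isometry_chart e p).dist_eq, dist_comm] at hdist
    refine hdis.le_bot ⟨?_, hy⟩
    rw [← hy', chart_mem_intrinsicInterior_iff hp]
    exact hb hdist
  · refine measure_mono_null (preimage_mono ?_) (h.null_inter_affineSpan h' hne hp)
    exact fun x hx => subset_affineSpan ℝ e' hx.2

/-! ### Cells -/

/-- A polytope `T` whose boundary is the union of the flat faces in `F`. -/
structure IsCell (T : Set (Pt d)) (F : Finset (Set (Pt d))) : Prop where
  isElement : IsElement T
  isFlatFace : ∀ e ∈ F, IsFlatFace e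
  frontier_eq : frontier T = ⋃ e ∈ F, e
  disjoint_faces : ∀ e ∈ F, ∀ e' ∈ F, e ≠ e' →
    Disjoint (intrinsicInterior ℝ e) (intrinsicInterior ℝ e')
  isOutwardNormal : ∀ e ∈ F, IsOutwardNormal T e (outwardNormal T e)

theorem PolytopalMesh.mem_facesOf {Ω : Set (Pt d)} (M : PolytopalMesh Ω) {T e : Set (Pt d)} :
    e ∈ M.facesOf T ↔ e ∈ M.faces ∧ e ⊆ frontier T := by
  simp [PolytopalMesh.facesOf]

theorem PolytopalMesh.isCell {Ω : Set (Pt d)} (M : PolytopalMesh Ω) {T : Set (Pt d)}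
    (hT : T ∈ M.elements) : IsCell T (M.facesOf T) where
  isElement := M.isElement T hT
  isFlatFace e he := M.isFlatFace e (M.mem_facesOf.1 he).1
  frontier_eq := by
    rw [M.frontier_eq T hT, sUnion_eq_biUnion]
    simp only [M.mem_facesOf, mem_ofPred_eq]
  disjoint_faces e he e' he' :=
    M.disjoint_faces e (M.mem_facesOf.1 he).1 e' (M.mem_facesOf.1 he').1
  isOutwardNormal e he :=
    Classical.epsilon_spec (M.exists_normal T hT e (M.mem_facesOf.1 he).1 (M.mem_facesOf.1 he).2)

theorem IsOutwardNormal.inner_vectorSpan {T e : Set (Pt d)} {n : Pt d} (h : IsOutwardNormal T e n) :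
    ∀ w ∈ vectorSpan ℝ e, inner ℝ n w = 0 := by
  intro w hw
  rw [vectorSpan_def] at hw
  induction hw using Submodule.span_induction with
  | mem x hx =>
    obtain ⟨a, ha, b, hb, rfl⟩ := hx
    exact h.orthogonal a ha b hb
  | zero => simp
  | add x y _ _ hx hy => rw [inner_add_right, hx, hy, add_zero]
  | smul c x _ hx => rw [inner_smul_right, hx, mul_zero]

theorem IsFlatFace.nonempty {e : Set (Pt d)} (h : IsFlatFace e) : e.Nonempty :=
  h.connected.nonempty.mono intrinsicInterior_subset

theorem IsElement.isCompact {T : Set (Pt d)} (h : IsElement T) : IsCompact T :=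
  h.polytopal.isCompact

theorem IsCell.face_subset {T : Set (Pt d)} {F : Finset (Set (Pt d))} (h : IsCell T F)
    {e : Set (Pt d)} (he : e ∈ F) : e ⊆ frontier T := by
  rw [h.frontier_eq]
  exact subset_biUnion_of_mem (u := fun e => e) he

theorem IsCell.face_subset_self {T : Set (Pt d)} {F : Finset (Set (Pt d))} (h : IsCell T F)
    {e : Set (Pt d)} (he : e ∈ F) : e ⊆ T :=
  (h.face_subset he).trans h.isElement.isCompact.isClosed.frontier_subset

/-- Near a point of a single face, `T` is a half ball. -/
theorem IsCell.local_side {T : Set (Pt d)} {F : Finset (Set (Pt d))} (h : IsCell T F)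
    {e : Set (Pt d)} (he : e ∈ F) {y : Pt d} (hy : y ∈ intrinsicInterior ℝ e)
    (hoth : ∀ e' ∈ F, e' ≠ e → y ∉ e') :
    ∃ ε > 0, ∀ z ∈ Metric.ball y ε,
      (inner ℝ (outwardNormal T e) (z - y) < (0 : ℝ) → z ∈ interior T) ∧
      ((0 : ℝ) < inner ℝ (outwardNormal T e) (z - y) → z ∉ T) := by
  classical
  have hn := h.isOutwardNormal e he
  set n := outwardNormal T e
  have hclosed : IsClosed (⋃ e' ∈ F.erase e, e') :=
    (F.erase e).finite_toSet.isClosed_biUnion fun e' he' =>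
      (h.isFlatFace e' (Finset.mem_of_mem_erase he')).isCompact.isClosed
  have hyc : y ∈ (⋃ e' ∈ F.erase e, e')ᶜ := by
    simp only [mem_compl_iff, mem_iUnion, not_exists]
    exact fun e' he' => hoth e' (Finset.mem_of_mem_erase he') (Finset.ne_of_mem_erase he')
  obtain ⟨ε, hε, hb⟩ := Metric.isOpen_iff.1 hclosed.isOpen_compl y hyc
  have hfr : ∀ z ∈ Metric.ball y ε, z ∈ frontier T → inner ℝ n (z - y) = (0 : ℝ) := by
    intro z hz hzT
    rw [h.frontier_eq] at hzT
    obtain ⟨e', he', hz'⟩ := mem_iUnion₂.1 hzT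
    by_cases hee : e' = e
    · subst hee
      exact hn.orthogonal z hz' y (intrinsicInterior_subset hy)
    · exact absurd (mem_biUnion (Finset.mem_coe.2 (Finset.mem_erase.2 ⟨hee, he'⟩)) hz' :
        z ∈ ⋃ e' ∈ (F.erase e : Set (Set (Pt d))), e') (hb hz)
  have hcover : ∀ z ∈ Metric.ball y ε, inner ℝ n (z - y) ≠ (0 : ℝ) → z ∈ interior T ∪ Tᶜ := by
    intro z hz hne
    by_contra hcon
    simp only [mem_union, mem_compl_iff, not_or, not_not] at hcon
    exact hne (hfr z hz ⟨subset_closure hcon.2, hcon.1⟩)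
  have hdisj : Disjoint (interior T) Tᶜ :=
    disjoint_compl_right.mono_left interior_subset
  have hlin : IsLinearMap ℝ (fun z : Pt d => inner ℝ n z) :=
    ⟨fun a b => inner_add_right _ _ _, fun c a => by simp [inner_smul_right]⟩
  have hcm : Convex ℝ (Metric.ball y ε ∩ {z | inner ℝ n z < inner ℝ n y}) :=
    (convex_ball y ε).inter (convex_halfSpace_lt hlin _)
  have hcp : Convex ℝ (Metric.ball y ε ∩ {z | inner ℝ n y < inner ℝ n z}) :=
    (convex_ball y ε).inter (convex_halfSpace_gt hlin _)
  have hball : ∀ᶠ t : ℝ in 𝓝[>] 0, t < ε := by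
    filter_upwards [Ioo_mem_nhdsGT hε] with t ht using ht.2
  obtain ⟨t, ⟨⟨hin, hout⟩, htε⟩, ht0⟩ :=
    ((hn.outward y hy).and hball |>.and self_mem_nhdsWithin).exists
  have ht0 : 0 < t := ht0
  have hnn : inner ℝ n n = (1 : ℝ) := by rw [real_inner_self_eq_norm_sq, hn.norm_eq]; norm_num
  have hd1 : y - t • n ∈ Metric.ball y ε := by
    rw [mem_ball_iff_norm, sub_sub_cancel_left, norm_neg, norm_smul, hn.norm_eq, mul_one,
      Real.norm_of_nonneg ht0.le]
    exact htε
  have hd2 : y + t • n ∈ Metric.ball y ε := by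
    rw [mem_ball_iff_norm, add_sub_cancel_left, norm_smul, hn.norm_eq, mul_one,
      Real.norm_of_nonneg ht0.le]
    exact htε
  have hm : ((Metric.ball y ε ∩ {z | inner ℝ n z < inner ℝ n y}) ∩ interior T).Nonempty := by
    refine ⟨y - t • n, ⟨hd1, ?_⟩, hin⟩
    rw [mem_ofPred_eq, inner_sub_right, inner_smul_right, hnn]
    linarith
  have hp : ((Metric.ball y ε ∩ {z | inner ℝ n y < inner ℝ n z}) ∩ Tᶜ).Nonempty := by
    refine ⟨y + t • n, ⟨hd2, ?_⟩, hout⟩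
    rw [mem_ofPred_eq, inner_add_right, inner_smul_right, hnn]
    linarith
  have ho := h.isElement.isCompact.isClosed.isOpen_compl
  -- Inside the ball the frontier of `T` lies in the hyperplane of `e`. Each open half ball is
  -- connected and avoids it, so it is entirely inside or entirely outside; one point on the normal
  -- line decides which.
  have hsm := hcm.isPreconnected.subset_left_of_subset_union isOpen_interior ho hdisj
    (fun a ha => hcover a ha.1 (by rw [inner_sub_right]; exact (sub_neg.2 ha.2).ne)) hm
  have hsp := hcp.isPreconnected.subset_right_of_subset_union isOpen_interior ho hdisj
    (fun a ha => hcover a ha.1 (by rw [inner_sub_right]; exact (sub_pos.2 ha.2).ne')) hp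
  refine ⟨ε, hε, fun z hz => ⟨fun hz0 => hsm ⟨hz, ?_⟩, fun hz0 => hsp ⟨hz, ?_⟩⟩⟩
  · rw [inner_sub_right] at hz0
    exact sub_neg.1 hz0
  · rw [inner_sub_right] at hz0
    exact sub_pos.1 hz0

/-! ### Generic lines -/

/-- In skew coordinates the union of the lines through `N` lies in the product of the null set `N`
with `ℝ`. -/
theorem IsFlatFace.ae_line_notMem {e : Set (Pt d)} (h : IsFlatFace e) (hd : 1 ≤ d) {n : Pt d}
    (hn : ‖n‖ = 1) (hort : ∀ w ∈ vectorSpan ℝ e, inner ℝ n w = 0) {p : Pt d} (hp : p ∈ e)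
    {u : Pt d} (hu : inner ℝ n u ≠ (0 : ℝ)) {N : Set (Pt d)} (hNe : N ⊆ e)
    (hN : volume (chart e p ⁻¹' N) = 0) : ∀ᵐ x : Pt d, ∀ t : ℝ, x + t • u ∉ N := by
  rw [ae_iff]
  refine null_of_preimage_skew (vectorSpan ℝ e) hd h.finrank_eq n hn hort p u hu ?_
  refine measure_mono_null (t := (chart e p ⁻¹' N) ×ˢ (univ : Set ℝ)) ?_ ?_
  · rintro ⟨w, s⟩ hws
    simp only [mem_preimage, mem_ofPred_eq, not_forall, not_not, skew] at hws
    obtain ⟨t, ht⟩ := hws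
    have h1 := hort _ (vsub_mem_vectorSpan ℝ (hNe ht) hp)
    have h2 : p + (w : Pt d) + s • u + t • u -ᵥ p = (w : Pt d) + (s + t) • u := by
      rw [vsub_eq_sub, add_smul]; abel
    rw [h2, inner_add_right, hort _ w.2, inner_smul_right, zero_add] at h1
    have h3 : s + t = 0 := (mul_eq_zero.1 h1).resolve_right hu
    refine ⟨?_, trivial⟩
    have h4 : p + (w : Pt d) + s • u + t • u = chart e p w := by
      rw [add_assoc, ← add_smul, h3, zero_smul, add_zero, chart]
    rw [h4] at ht
    exact ht
  · rw [Measure.volume_eq_prod, Measure.prod_prod, hN, zero_mul]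

/-- A line parallel to the hyperplane of `e` that meets `e` stays in this hyperplane, which is null.
-/
theorem IsFlatFace.ae_line_notMem_of_parallel {e : Set (Pt d)} {n : Pt d}
    (hn : ‖n‖ = 1) (hort : ∀ w ∈ vectorSpan ℝ e, inner ℝ n w = 0) {p : Pt d} (hp : p ∈ e)
    {u : Pt d} (hu : inner ℝ n u = (0 : ℝ)) : ∀ᵐ x : Pt d, ∀ t : ℝ, x + t • u ∉ e := by
  have hK : (LinearMap.ker (innerₛₗ ℝ n : Pt d →ₗ[ℝ] ℝ)) ≠ ⊤ := by
    intro htop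
    have : n ∈ LinearMap.ker (innerₛₗ ℝ n : Pt d →ₗ[ℝ] ℝ) := by rw [htop]; trivial
    rw [LinearMap.mem_ker, innerₛₗ_apply_apply, real_inner_self_eq_norm_sq, hn] at this
    norm_num at this
  have h0 := Measure.addHaar_submodule (volume : Measure (Pt d)) _ hK
  have h1 := measure_preimage_add (volume : Measure (Pt d)) (-p)
    (LinearMap.ker (innerₛₗ ℝ n : Pt d →ₗ[ℝ] ℝ) : Set (Pt d))
  rw [h0] at h1
  rw [ae_iff]
  refine measure_mono_null (fun x hx => ?_) h1
  simp only [mem_ofPred_eq, not_forall, not_not] at hx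
  obtain ⟨t, ht⟩ := hx
  have h2 := hort _ (vsub_mem_vectorSpan ℝ ht hp)
  simp only [vsub_eq_sub, inner_sub_right, inner_add_right, inner_smul_right, hu, mul_zero, add_zero] at h2
  simp only [mem_preimage, SetLike.mem_coe, LinearMap.mem_ker, innerₛₗ_apply_apply, inner_add_right,
    inner_neg_right]
  linarith

/-- Almost every line in direction `u` meets a face only transversally, in its relative interior,
and away from the other faces. -/
theorem ae_line_generic (hd : 1 ≤ d) {G : Finset (Set (Pt d))} (hG : ∀ e ∈ G, IsFlatFace e)
    (hdis : ∀ e ∈ G, ∀ e' ∈ G, e ≠ e' →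
      Disjoint (intrinsicInterior ℝ e) (intrinsicInterior ℝ e'))
    {e : Set (Pt d)} (he : e ∈ G) {n : Pt d} (hn : ‖n‖ = 1)
    (hort : ∀ w ∈ vectorSpan ℝ e, inner ℝ n w = 0) (u : Pt d) :
    ∀ᵐ x : Pt d, ∀ t : ℝ, x + t • u ∈ e → inner ℝ n u ≠ (0 : ℝ) ∧
      x + t • u ∈ intrinsicInterior ℝ e ∧ ∀ e' ∈ G, e' ≠ e → x + t • u ∉ e' := by
  obtain ⟨p, hp⟩ := (hG e he).nonempty
  by_cases hu : inner ℝ n u = (0 : ℝ)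
  · filter_upwards [IsFlatFace.ae_line_notMem_of_parallel hn hort hp hu] with x hx t ht
    exact absurd ht (hx t)
  have h1 := (hG e he).ae_line_notMem hd hn hort hp hu sdiff_subset ((hG e he).null_boundary hp)
  have h2 : ∀ᵐ x : Pt d, ∀ e' ∈ G, e' ≠ e → ∀ t : ℝ, x + t • u ∉ e ∩ e' := by
    rw [Filter.eventually_all_finset]
    intro e' he'
    rw [Filter.eventually_imp_distrib_left]
    intro hne
    exact (hG e he).ae_line_notMem hd hn hort hp hu inter_subset_left
      ((hG e he).null_inter (hG e' he') (hdis e he e' he' hne.symm) hp)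
  filter_upwards [h1, h2] with x hx1 hx2 t ht
  refine ⟨hu, ?_, fun e' he' hne ht' => hx2 e' he' hne t ⟨ht, ht'⟩⟩
  by_contra hcon
  exact hx1 t ⟨ht, hcon⟩

/-! ### Jumps of piecewise constant functions on the line -/

/-- `f` is constant on both sides of `t`, and its left value minus its right value is `a`. -/
def HasJump (f : ℝ → ℝ) (t a : ℝ) : Prop :=
  ∃ l r, (∀ᶠ s in 𝓝[<] t, f s = l) ∧ (∀ᶠ s in 𝓝[>] t, f s = r) ∧ l - r = a

theorem HasJump.sub {f g : ℝ → ℝ} {t a b : ℝ} (hf : HasJump f t a) (hg : HasJump g t b) :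
    HasJump (fun s => f s - g s) t (a - b) := by
  obtain ⟨l, r, hl, hr, rfl⟩ := hf
  obtain ⟨l', r', hl', hr', rfl⟩ := hg
  refine ⟨l - l', r - r', ?_, ?_, by ring⟩
  · filter_upwards [hl, hl'] with s h1 h2 using by rw [h1, h2]
  · filter_upwards [hr, hr'] with s h1 h2 using by rw [h1, h2]

theorem HasJump.const_mul {f : ℝ → ℝ} {t a : ℝ} (c : ℝ) (hf : HasJump f t a) :
    HasJump (fun s => c * f s) t (c * a) := by
  obtain ⟨l, r, hl, hr, rfl⟩ := hf
  refine ⟨c * l, c * r, ?_, ?_, by ring⟩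
  · filter_upwards [hl] with s h1 using by rw [h1]
  · filter_upwards [hr] with s h1 using by rw [h1]

theorem HasJump.sum {ι : Type*} {I : Finset ι} {f : ι → ℝ → ℝ} {t : ℝ} {a : ι → ℝ}
    (hf : ∀ i ∈ I, HasJump (f i) t (a i)) : HasJump (fun s => ∑ i ∈ I, f i s) t (∑ i ∈ I, a i) := by
  choose! l r hl hr ha using hf
  refine ⟨∑ i ∈ I, l i, ∑ i ∈ I, r i, ?_, ?_, ?_⟩
  · filter_upwards [(Filter.eventually_all_finset I).2 hl] with s h using Finset.sum_congr rfl h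
  · filter_upwards [(Filter.eventually_all_finset I).2 hr] with s h using Finset.sum_congr rfl h
  · rw [← Finset.sum_sub_distrib]
    exact Finset.sum_congr rfl ha

theorem HasJump.unique {f : ℝ → ℝ} {t a b : ℝ} (h : HasJump f t a) (h' : HasJump f t b) :
    a = b := by
  obtain ⟨l, r, hl, hr, rfl⟩ := h
  obtain ⟨l', r', hl', hr', rfl⟩ := h'
  obtain ⟨s, h1, h2⟩ := (hl.and hl').exists
  obtain ⟨s', h3, h4⟩ := (hr.and hr').exists
  rw [← h1, ← h3, ← h2, ← h4]

theorem hasJump_zero_of_eventually {f : ℝ → ℝ} {t c : ℝ} (h : ∀ᶠ s in 𝓝 t, f s = c) :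
    HasJump f t 0 :=
  ⟨c, c, h.filter_mono nhdsWithin_le_nhds, h.filter_mono nhdsWithin_le_nhds, sub_self c⟩

theorem HasJump.eventually {f : ℝ → ℝ} {t : ℝ} (h : HasJump f t 0) :
    ∃ c, ∀ᶠ s in 𝓝[≠] t, f s = c := by
  obtain ⟨l, r, hl, hr, ha⟩ := h
  obtain rfl : l = r := by linarith
  refine ⟨l, ?_⟩
  rw [← nhdsLT_sup_nhdsGT, eventually_sup]
  exact ⟨hl, hr⟩

/-- A zero jump says nothing about the value at the point itself. Replacing each value by the common
one-sided value gives a locally constant function on the line, hence a constant one, and far out it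
is zero. For this reason the conclusion concerns punctured neighbourhoods. -/
theorem eq_zero_of_hasJump_zero {f : ℝ → ℝ} (hf : ∀ t, HasJump f t 0)
    (hinf : ∀ᶠ t in atTop, f t = 0) {t c : ℝ} (hc : ∀ᶠ s in 𝓝[≠] t, f s = c) : c = 0 := by
  choose v hv using fun t => (hf t).eventually
  have hloc : IsLocallyConstant v := by
    rw [IsLocallyConstant.iff_eventually_eq]
    intro t
    filter_upwards [eventually_eventually_nhds.2 (eventually_nhdsWithin_iff.1 (hv t))] with s hs
    by_cases hst : s = t
    · rw [hst]
    · have h1 : ∀ᶠ r in 𝓝[≠] s, r ≠ t := (isOpen_ne.mem_nhds hst : _) |> mem_nhdsWithin_of_mem_nhds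
      obtain ⟨r, ⟨hr1, hr2⟩, hr3⟩ := ((hv s).and h1 |>.and (hs.filter_mono nhdsWithin_le_nhds)).exists
      rw [← hr1, hr3 hr2]
  obtain ⟨M, hM⟩ := eventually_atTop.1 hinf
  have h1 : v t = v (M + 1) := hloc.apply_eq_of_preconnectedSpace _ _
  have h2 : v t = c := by
    obtain ⟨s, hs, hs'⟩ := ((hv t).and hc).exists
    rw [← hs, hs']
  have h3 : ∀ᶠ s in 𝓝[≠] (M + 1), M ≤ s :=
    (eventually_ge_nhds (by linarith)).filter_mono nhdsWithin_le_nhds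
  obtain ⟨s, hs, hs'⟩ := ((hv (M + 1)).and h3).exists
  rw [← h2, h1, ← hs, hM s hs']

/-! ### Shadows -/

/-- The points from which `e` is visible in direction `u`. -/
def shadow (u : Pt d) (e : Set (Pt d)) : Set (Pt d) := {x | ∃ t : ℝ, 0 ≤ t ∧ x + t • u ∈ e}

/-- The characteristic function of `S`, with real values. -/
def ind (S : Set (Pt d)) (x : Pt d) : ℝ := S.indicator (fun _ => (1 : ℝ)) x

theorem ind_of_mem {S : Set (Pt d)} {x : Pt d} (h : x ∈ S) : ind S x = 1 := indicator_of_mem h _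

theorem ind_of_notMem {S : Set (Pt d)} {x : Pt d} (h : x ∉ S) : ind S x = 0 :=
  indicator_of_notMem h _

theorem line_hit_unique {e : Set (Pt d)} {n : Pt d}
    (hort : ∀ w ∈ vectorSpan ℝ e, inner ℝ n w = 0) {x u : Pt d} (hu : inner ℝ n u ≠ (0 : ℝ))
    {s t : ℝ} (hs : x + s • u ∈ e) (ht : x + t • u ∈ e) : s = t := by
  have h1 := hort _ (vsub_mem_vectorSpan ℝ hs ht)
  have h2 : x + s • u -ᵥ (x + t • u) = (s - t) • u := by
    rw [vsub_eq_sub, sub_smul]; abel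
  rw [h2, inner_smul_right] at h1
  exact sub_eq_zero.1 ((mul_eq_zero.1 h1).resolve_right hu)

/-- On a line that meets `e` in one point only, the shadow of `e` is a half line. -/
theorem mem_shadow_line {e : Set (Pt d)} {n : Pt d}
    (hort : ∀ w ∈ vectorSpan ℝ e, inner ℝ n w = 0) {x u : Pt d} (hu : inner ℝ n u ≠ (0 : ℝ))
    {t : ℝ} (ht : x + t • u ∈ e) (s : ℝ) : x + s • u ∈ shadow u e ↔ s ≤ t := by
  have h1 : ∀ τ : ℝ, x + s • u + τ • u = x + (s + τ) • u := fun τ => by rw [add_smul]; abel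
  constructor
  · rintro ⟨τ, hτ, h⟩
    rw [h1] at h
    have := line_hit_unique hort hu h ht
    linarith
  · intro h
    refine ⟨t - s, by linarith, ?_⟩
    rw [h1]
    simpa using ht

theorem notMem_shadow_line {e : Set (Pt d)} {x u : Pt d} (h : ∀ t : ℝ, x + t • u ∉ e) (s : ℝ) :
    x + s • u ∉ shadow u e := by
  rintro ⟨τ, -, hτ⟩
  refine h (s + τ) ?_
  rw [add_smul, ← add_assoc]
  exact hτ

section Line

variable {e : Set (Pt d)} {n : Pt d} {x u : Pt d}

theorem hasJump_shadow (hort : ∀ w ∈ vectorSpan ℝ e, inner ℝ n w = 0)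
    (hu : inner ℝ n u ≠ (0 : ℝ)) {t : ℝ} (ht : x + t • u ∈ e) :
    HasJump (fun s => ind (shadow u e) (x + s • u)) t 1 := by
  refine ⟨1, 0, ?_, ?_, by norm_num⟩
  · filter_upwards [self_mem_nhdsWithin] with s hs
    exact ind_of_mem ((mem_shadow_line hort hu ht s).2 (le_of_lt hs))
  · filter_upwards [self_mem_nhdsWithin] with s hs
    exact ind_of_notMem fun hcon => absurd ((mem_shadow_line hort hu ht s).1 hcon) (not_le.2 hs)

/-- A line that misses `e` misses its shadow too, so transversality is demanded only if there is a
hit. -/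
theorem eventually_shadow (hort : ∀ w ∈ vectorSpan ℝ e, inner ℝ n w = 0)
    (hgen : ∀ t : ℝ, x + t • u ∈ e → inner ℝ n u ≠ (0 : ℝ)) {t : ℝ} (ht : x + t • u ∉ e) :
    ∀ᶠ s in 𝓝 t, ind (shadow u e) (x + s • u) = ind (shadow u e) (x + t • u) := by
  by_cases hh : ∃ t' : ℝ, x + t' • u ∈ e
  · obtain ⟨t', ht'⟩ := hh
    have hm := mem_shadow_line hort (hgen t' ht') ht'
    have hne : t ≠ t' := fun h => ht (h ▸ ht')
    rcases lt_or_gt_of_ne hne with hlt | hlt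
    · filter_upwards [eventually_lt_nhds hlt] with s hs
      rw [ind_of_mem ((hm s).2 hs.le), ind_of_mem ((hm t).2 hlt.le)]
    · filter_upwards [eventually_gt_nhds hlt] with s hs
      rw [ind_of_notMem fun hcon => absurd ((hm s).1 hcon) (not_le.2 hs),
        ind_of_notMem fun hcon => absurd ((hm t).1 hcon) (not_le.2 hlt)]
  · push Not at hh
    refine Eventually.of_forall fun s => ?_
    rw [ind_of_notMem (notMem_shadow_line hh s), ind_of_notMem (notMem_shadow_line hh t)]

theorem eventually_atTop_shadow (hort : ∀ w ∈ vectorSpan ℝ e, inner ℝ n w = 0)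
    (hgen : ∀ t : ℝ, x + t • u ∈ e → inner ℝ n u ≠ (0 : ℝ)) :
    ∀ᶠ s : ℝ in atTop, ind (shadow u e) (x + s • u) = 0 := by
  by_cases hh : ∃ t' : ℝ, x + t' • u ∈ e
  · obtain ⟨t', ht'⟩ := hh
    filter_upwards [eventually_gt_atTop t'] with s (hs : t' < s)
    exact ind_of_notMem fun hcon =>
      absurd ((mem_shadow_line hort (hgen t' ht') ht' s).1 hcon) (not_le.2 hs)
  · push Not at hh
    exact Eventually.of_forall fun s => ind_of_notMem (notMem_shadow_line hh s)

end Line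

theorem eventually_ind_of_notMem_frontier {T : Set (Pt d)} {y : Pt d} (hy : y ∉ frontier T) :
    ∀ᶠ z in 𝓝 y, ind T z = ind T y := by
  by_cases hyT : y ∈ interior T
  · filter_upwards [isOpen_interior.mem_nhds hyT] with z hz
    rw [ind_of_mem (interior_subset hz), ind_of_mem (interior_subset hyT)]
  · have : y ∈ (closure T)ᶜ := fun h => hy ⟨h, hyT⟩
    filter_upwards [isClosed_closure.isOpen_compl.mem_nhds this] with z hz
    rw [ind_of_notMem fun h => hz (subset_closure h), ind_of_notMem fun h => this (subset_closure h)]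

theorem eventually_ind_line_of_notMem_frontier {T : Set (Pt d)} {x u : Pt d} {t : ℝ}
    (hy : x + t • u ∉ frontier T) :
    ∀ᶠ s in 𝓝 t, ind T (x + s • u) = ind T (x + t • u) := by
  have hc : Continuous fun s : ℝ => x + s • u := by fun_prop
  exact hc.continuousAt.eventually (eventually_ind_of_notMem_frontier hy)

theorem eventually_atTop_ind {T : Set (Pt d)} (hT : IsCompact T) (x : Pt d) {u : Pt d}
    (hu : u ≠ 0) : ∀ᶠ s : ℝ in atTop, ind T (x + s • u) = 0 := by
  obtain ⟨R, hR⟩ := hT.isBounded.subset_closedBall 0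
  have hu' : 0 < ‖u‖ := norm_pos_iff.2 hu
  filter_upwards [eventually_gt_atTop ((R + ‖x‖) / ‖u‖), eventually_ge_atTop 0] with s hs hs0
  refine ind_of_notMem fun hmem => ?_
  have h1 := mem_closedBall_zero_iff.1 (hR hmem)
  have h2 : ‖s • u‖ ≤ ‖x + s • u‖ + ‖x‖ := by
    have := norm_sub_le (x + s • u) x
    rwa [add_sub_cancel_left] at this
  rw [norm_smul, Real.norm_of_nonneg hs0] at h2
  rw [div_lt_iff₀ hu'] at hs
  linarith

theorem IsCell.ae_notMem_frontier {T : Set (Pt d)} {F : Finset (Set (Pt d))} (h : IsCell T F) :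
    ∀ᵐ x : Pt d, x ∉ frontier T := by
  have h1 : ∀ᵐ x : Pt d, ∀ e ∈ F, x ∉ e := by
    rw [Filter.eventually_all_finset]
    intro e he
    have hn := h.isOutwardNormal e he
    obtain ⟨p, hp⟩ := (h.isFlatFace e he).nonempty
    filter_upwards [IsFlatFace.ae_line_notMem_of_parallel hn.norm_eq hn.inner_vectorSpan hp
      (inner_zero_right _)] with x hx
    simpa using hx 0
  filter_upwards [h1] with x hx
  rw [h.frontier_eq]
  simpa using hx

/-- By `local_side`, moving along `u` through `e` leaves `T` when `u` points outward (left value 1,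
right value 0) and enters it when `u` points inward. -/
theorem IsCell.hasJump_ind {T : Set (Pt d)} {F : Finset (Set (Pt d))} (h : IsCell T F)
    {e : Set (Pt d)} (he : e ∈ F) {x u : Pt d} {t : ℝ}
    (hu : inner ℝ (outwardNormal T e) u ≠ (0 : ℝ))
    (hy : x + t • u ∈ intrinsicInterior ℝ e) (hoth : ∀ e' ∈ F, e' ≠ e → x + t • u ∉ e') :
    HasJump (fun s => ind T (x + s • u)) t (SignType.sign (inner ℝ (outwardNormal T e) u : ℝ)) := by
  obtain ⟨ε, hε, hb⟩ := h.local_side he hy hoth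
  have hc : Continuous fun s : ℝ => x + s • u := by fun_prop
  have hnear : ∀ᶠ s in 𝓝 t, x + s • u ∈ Metric.ball (x + t • u) ε :=
    hc.continuousAt.eventually (Metric.ball_mem_nhds _ hε)
  have hinner : ∀ s : ℝ, inner ℝ (outwardNormal T e) (x + s • u - (x + t • u)) =
      (s - t) * inner ℝ (outwardNormal T e) u := by
    intro s
    rw [show x + s • u - (x + t • u) = (s - t) • u by rw [sub_smul]; abel, inner_smul_right]
  have key : ∀ᶠ s in 𝓝 t,
      ((s - t) * inner ℝ (outwardNormal T e) u < 0 → ind T (x + s • u) = 1) ∧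
      (0 < (s - t) * inner ℝ (outwardNormal T e) u → ind T (x + s • u) = 0) := by
    filter_upwards [hnear] with s hs
    have := hb _ hs
    rw [hinner] at this
    exact ⟨fun h' => ind_of_mem (interior_subset (this.1 h')), fun h' => ind_of_notMem (this.2 h')⟩
  have keyl := key.filter_mono (nhdsWithin_le_nhds (s := Iio t))
  have keyr := key.filter_mono (nhdsWithin_le_nhds (s := Ioi t))
  rcases lt_or_gt_of_ne hu with hlt | hlt
  · refine ⟨0, 1, ?_, ?_, by rw [sign_neg hlt]; norm_num⟩
    · filter_upwards [keyl, self_mem_nhdsWithin] with s hs hst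
      exact hs.2 (mul_pos_of_neg_of_neg (sub_neg.2 hst) hlt)
    · filter_upwards [keyr, self_mem_nhdsWithin] with s hs hst
      exact hs.1 (mul_neg_of_pos_of_neg (sub_pos.2 hst) hlt)
  · refine ⟨1, 0, ?_, ?_, by rw [sign_pos hlt]; norm_num⟩
    · filter_upwards [keyl, self_mem_nhdsWithin] with s hs hst
      exact hs.1 (mul_neg_of_neg_of_pos (sub_neg.2 hst) hlt)
    · filter_upwards [keyr, self_mem_nhdsWithin] with s hs hst
      exact hs.2 (mul_pos (sub_pos.2 hst) hlt)

/-- The characteristic function of `T` is a signed sum of those of the shadows of its faces. -/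
theorem IsCell.ind_eq_sum_shadow {T : Set (Pt d)} {F : Finset (Set (Pt d))} (h : IsCell T F)
    (hd : 1 ≤ d) {u : Pt d} (hu : u ≠ 0) :
    ∀ᵐ x : Pt d, ind T x =
      ∑ e ∈ F, SignType.sign (inner ℝ (outwardNormal T e) u : ℝ) * ind (shadow u e) x := by
  have hgen : ∀ᵐ x : Pt d, ∀ e ∈ F, ∀ t : ℝ, x + t • u ∈ e →
      inner ℝ (outwardNormal T e) u ≠ (0 : ℝ) ∧
      x + t • u ∈ intrinsicInterior ℝ e ∧ ∀ e' ∈ F, e' ≠ e → x + t • u ∉ e' := by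
    rw [Filter.eventually_all_finset]
    intro e he
    exact ae_line_generic hd h.isFlatFace h.disjoint_faces he (h.isOutwardNormal e he).norm_eq
      (h.isOutwardNormal e he).inner_vectorSpan u
  filter_upwards [hgen, h.ae_notMem_frontier] with x hx hx0
  have hort := fun e he => (h.isOutwardNormal e he).inner_vectorSpan
  set σ : Set (Pt d) → ℝ := fun e => SignType.sign (inner ℝ (outwardNormal T e) u : ℝ)
  -- Where the line hits a face `e`, both terms jump by the sign of `n_e · u`; elsewhere neither
  -- jumps. Both vanish near `+∞`, so the difference is zero on the whole line up to isolated
  -- values.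
  let f : ℝ → ℝ := fun s => ind T (x + s • u) - ∑ e ∈ F, σ e * ind (shadow u e) (x + s • u)
  have hj0 : ∀ t, ∀ e ∈ F, x + t • u ∉ e →
      HasJump (fun s => σ e * ind (shadow u e) (x + s • u)) t 0 := fun t e he hte =>
    mul_zero (σ e) ▸ (hasJump_zero_of_eventually
      (eventually_shadow (hort e he) (fun t ht => (hx e he t ht).1) hte)).const_mul (σ e)
  have hjump : ∀ t, HasJump f t 0 := by
    classical
    intro t
    by_cases hit : ∃ e ∈ F, x + t • u ∈ e
    · obtain ⟨e, he, hte⟩ := hit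
      obtain ⟨h1, h2, h3⟩ := hx e he t hte
      have hsum : HasJump (fun s => ∑ e' ∈ F, σ e' * ind (shadow u e') (x + s • u)) t
          (∑ e' ∈ F, if e' = e then σ e else 0) := by
        refine HasJump.sum fun e' he' => ?_
        split_ifs with hee
        · subst hee
          simpa using (hasJump_shadow (hort e' he') h1 hte).const_mul (σ e')
        · exact hj0 t e' he' (h3 e' he' hee)
      have := (h.hasJump_ind he h1 h2 h3).sub hsum
      rwa [Finset.sum_ite_eq_of_mem' F e _ he, sub_self] at this
    · push Not at hit
      have hT : x + t • u ∉ frontier T := by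
        rw [h.frontier_eq]
        simpa using hit
      have hsum : HasJump (fun s => ∑ e' ∈ F, σ e' * ind (shadow u e') (x + s • u)) t
          (∑ e' ∈ F, 0) := HasJump.sum fun e' he' => hj0 t e' he' (hit e' he')
      have := (hasJump_zero_of_eventually (eventually_ind_line_of_notMem_frontier hT)).sub hsum
      simpa using this
  have hinf : ∀ᶠ s in atTop, f s = 0 := by
    have h1 : ∀ᶠ s in atTop, ∀ e ∈ F, ind (shadow u e) (x + s • u) = 0 :=
      (Filter.eventually_all_finset F).2 fun e he =>
        eventually_atTop_shadow (hort e he) (fun t ht => (hx e he t ht).1)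
    filter_upwards [h1, eventually_atTop_ind h.isElement.isCompact x hu] with s hs hs'
    simp only [f, hs', zero_sub, neg_eq_zero]
    exact Finset.sum_eq_zero fun e he => by rw [hs e he, mul_zero]
  -- The base point lies on no face, so the value of `f` at `0` agrees with its values nearby.
  have hnear : ∀ᶠ s in 𝓝 (0 : ℝ), f s = f 0 := by
    have h1 : ∀ᶠ s in 𝓝 (0 : ℝ), ∀ e ∈ F,
        ind (shadow u e) (x + s • u) = ind (shadow u e) (x + (0 : ℝ) • u) :=
      (Filter.eventually_all_finset F).2 fun e he =>
        eventually_shadow (hort e he) (fun t ht => (hx e he t ht).1)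
          fun hcon => hx0 (h.face_subset he (by simpa using hcon))
    filter_upwards [h1, eventually_ind_line_of_notMem_frontier (T := T) (x := x) (u := u) (t := 0)
      (by simpa using hx0)] with s hs hs'
    simp only [f, hs']
    congr 1
    exact Finset.sum_congr rfl fun e he => by rw [hs e he]
  have := eq_zero_of_hasJump_zero hjump hinf (hnear.filter_mono nhdsWithin_le_nhds)
  simp only [f, zero_smul, add_zero] at this
  linarith

/-! ### The divergence theorem -/

section Shadow

variable {e : Set (Pt d)} {n : Pt d} {p u : Pt d}

/-- In skew coordinates a shadow is the half cylinder over `e`, which makes it measurable and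
accessible to Fubini. -/
theorem skew_mem_shadow (hort : ∀ w ∈ vectorSpan ℝ e, inner ℝ n w = 0) (hp : p ∈ e)
    (hu : inner ℝ n u ≠ (0 : ℝ)) (y : vectorSpan ℝ e × ℝ) :
    skew (vectorSpan ℝ e) p u y ∈ shadow u e ↔ y.1 ∈ chart e p ⁻¹' e ∧ y.2 ≤ 0 := by
  obtain ⟨w, t⟩ := y
  have hsk : skew (vectorSpan ℝ e) p u (w, t) = chart e p w + t • u := rfl
  by_cases hw : chart e p w ∈ e
  · have := mem_shadow_line hort hu (x := chart e p w) (t := 0) (by simpa using hw) t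
    rw [hsk, this]
    exact ⟨fun h => ⟨hw, h⟩, fun h => h.2⟩
  · refine ⟨?_, fun h => absurd h.1 hw⟩
    rintro ⟨τ, -, hτ⟩
    refine absurd ?_ hw
    have h1 := hort _ (vsub_mem_vectorSpan ℝ hτ hp)
    have h2 : skew (vectorSpan ℝ e) p u (w, t) + τ • u -ᵥ p = (w : Pt d) + (t + τ) • u := by
      rw [vsub_eq_sub, add_smul, skew]; abel
    rw [h2, inner_add_right, hort _ w.2, inner_smul_right, zero_add] at h1
    have h3 : t + τ = 0 := (mul_eq_zero.1 h1).resolve_right hu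
    rw [hsk, add_assoc, ← add_smul, h3, zero_smul, add_zero] at hτ
    exact hτ

theorem measurableSet_shadow (h : IsFlatFace e) (hort : ∀ w ∈ vectorSpan ℝ e, inner ℝ n w = 0)
    (hu : inner ℝ n u ≠ (0 : ℝ)) : MeasurableSet (shadow u e) := by
  obtain ⟨p, hp⟩ := h.nonempty
  have himg : shadow u e =
      skew (vectorSpan ℝ e) p u '' ((chart e p ⁻¹' e) ×ˢ Iic (0 : ℝ)) := by
    ext x
    constructor
    · rintro ⟨t, ht, hx⟩
      obtain ⟨w, hw⟩ := mem_range_chart hp hx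
      refine ⟨(w, -t), ⟨?_, ?_⟩, ?_⟩
      · rw [mem_preimage, hw]; exact hx
      · simpa using ht
      · change chart e p w + (-t) • u = x
        rw [hw, neg_smul]; abel
    · rintro ⟨y, hy, rfl⟩
      exact (skew_mem_shadow hort hp hu y).2 hy
  rw [himg]
  refine (measurableEmbedding_skew _ n hort p u hu).measurableSet_image.2 ?_
  exact ((continuous_chart e p).measurable h.isCompact.measurableSet).prod measurableSet_Iic

theorem integrable_ind_mul {S : Set (Pt d)} (hS : MeasurableSet S) {g : Pt d → ℝ}
    (hg : Integrable g) : Integrable (fun x => ind S x * g x) := by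
  have : (fun x => ind S x * g x) = S.indicator g := by
    ext x
    by_cases hx : x ∈ S
    · rw [ind_of_mem hx, indicator_of_mem hx, one_mul]
    · rw [ind_of_notMem hx, indicator_of_notMem hx, zero_mul]
  rw [this]
  exact hg.indicator hS

theorem integral_ind_mul {S : Set (Pt d)} (hS : MeasurableSet S) (g : Pt d → ℝ) :
    ∫ x, ind S x * g x = ∫ x in S, g x := by
  rw [← integral_indicator hS]
  congr 1
  ext x
  by_cases hx : x ∈ S
  · rw [ind_of_mem hx, indicator_of_mem hx, one_mul]
  · rw [ind_of_notMem hx, indicator_of_notMem hx, zero_mul]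

theorem integrable_fderiv_apply {φ : Pt d → ℝ} (hφ : ContDiff ℝ 1 φ) (hc : HasCompactSupport φ)
    (u : Pt d) : Integrable (fun x => fderiv ℝ φ x u) := by
  refine Continuous.integrable_of_hasCompactSupport ?_ (hc.fderiv_apply ℝ u)
  exact (hφ.continuous_fderiv one_ne_zero).clm_apply continuous_const

theorem integral_Iic_fderiv_line {φ : Pt d → ℝ} (hφ : ContDiff ℝ 1 φ) (hc : HasCompactSupport φ)
    (x : Pt d) {u : Pt d} (hu : u ≠ 0) :
    ∫ t in Iic (0 : ℝ), fderiv ℝ φ (x + t • u) u = φ x := by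
  have hemb : IsClosedEmbedding (fun t : ℝ => x + t • u) :=
    (Homeomorph.addLeft x).isClosedEmbedding.comp (isClosedEmbedding_smul_left hu)
  have hcomp : ContDiff ℝ 1 (fun t : ℝ => φ (x + t • u)) :=
    hφ.comp (contDiff_const.add (contDiff_id.smul contDiff_const))
  have h := HasCompactSupport.integral_Iic_deriv_eq hcomp (hc.comp_isClosedEmbedding hemb) 0
  rw [zero_smul, add_zero] at h
  rw [← h]
  congr 1
  ext t
  have h1 : HasDerivAt (fun t : ℝ => x + t • u) u t := by
    simpa using ((hasDerivAt_id t).smul_const u).const_add x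
  exact (((hφ.differentiable one_ne_zero _).hasFDerivAt.comp_hasDerivAt t h1).deriv).symm

/-- On each half line of the cylinder the derivative along `u` integrates to the value of `φ` at its
end point on `e`. The factor `|n · u|` is the Jacobian of the skew coordinates. -/
theorem integral_shadow (h : IsFlatFace e) (hd : 1 ≤ d)
    (hn : ‖n‖ = 1) (hort : ∀ w ∈ vectorSpan ℝ e, inner ℝ n w = 0)
    (hu : inner ℝ n u ≠ (0 : ℝ)) {φ : Pt d → ℝ} (hφ : ContDiff ℝ 1 φ)
    (hc : HasCompactSupport φ) :
    ∫ x, ind (shadow u e) x * fderiv ℝ φ x u =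
      |(inner ℝ n u : ℝ)| * ∫ x : e, φ x ∂(surface e) := by
  obtain ⟨p, hp⟩ := h.nonempty
  have hu0 : u ≠ 0 := by rintro rfl; simp at hu
  have hint := integrable_comp_skew (vectorSpan ℝ e) hd h.finrank_eq n hn hort p u hu
    (integrable_ind_mul (measurableSet_shadow h hort hu) (integrable_fderiv_apply hφ hc u))
  rw [integral_skew (vectorSpan ℝ e) hd h.finrank_eq n hn hort p u hu, h.integral_surface hp,
    Measure.volume_eq_prod, integral_prod _ hint,
    ← integral_indicator ((continuous_chart e p).measurable h.isCompact.measurableSet)]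
  congr 2
  ext w
  by_cases hw : w ∈ chart e p ⁻¹' e
  · rw [indicator_of_mem hw, ← integral_Iic_fderiv_line hφ hc (chart e p w) hu0,
      ← integral_indicator measurableSet_Iic]
    congr 1
    ext t
    by_cases ht : t ≤ 0
    · rw [ind_of_mem ((skew_mem_shadow hort hp hu (w, t)).2 ⟨hw, ht⟩), one_mul,
        indicator_of_mem (mem_Iic.2 ht)]
      rfl
    · rw [ind_of_notMem fun hcon => ht ((skew_mem_shadow hort hp hu (w, t)).1 hcon).2, zero_mul,
        indicator_of_notMem (by simpa using ht)]
  · rw [indicator_of_notMem hw]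
    refine (integral_congr_ae (Eventually.of_forall fun t => ?_)).trans (integral_zero _ _)
    change _ * _ = (0 : ℝ)
    rw [ind_of_notMem fun hcon => hw ((skew_mem_shadow hort hp hu (w, t)).1 hcon).1, zero_mul]

end Shadow

/-- The divergence theorem on a polytope, for compactly supported functions. -/
theorem IsCell.integral_fderiv {T : Set (Pt d)} {F : Finset (Set (Pt d))} (h : IsCell T F)
    (hd : 1 ≤ d) {φ : Pt d → ℝ} (hφ : ContDiff ℝ 1 φ) (hc : HasCompactSupport φ) (u : Pt d) :
    ∫ x in T, fderiv ℝ φ x u =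
      ∑ e ∈ F, inner ℝ (outwardNormal T e) u * ∫ x : e, φ x ∂(surface e) := by
  by_cases hu : u = 0
  · simp [hu]
  have hg := integrable_fderiv_apply hφ hc u
  rw [← integral_ind_mul h.isElement.isCompact.measurableSet]
  have h1 : ∫ x, ind T x * fderiv ℝ φ x u = ∫ x, ∑ e ∈ F,
      SignType.sign (inner ℝ (outwardNormal T e) u : ℝ) *
        (ind (shadow u e) x * fderiv ℝ φ x u) := by
    refine integral_congr_ae ?_
    filter_upwards [h.ind_eq_sum_shadow hd hu] with x hx
    rw [hx, Finset.sum_mul]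
    simp only [mul_assoc]
  rw [h1, integral_finsetSum]
  · refine Finset.sum_congr rfl fun e he => ?_
    rw [integral_const_mul]
    -- Faces parallel to `u` carry the factor zero on both sides, so nothing about their shadows is
    -- needed.
    by_cases hne : inner ℝ (outwardNormal T e) u = (0 : ℝ)
    · simp [hne]
    · have hn := h.isOutwardNormal e he
      rw [integral_shadow (h.isFlatFace e he) hd hn.norm_eq hn.inner_vectorSpan hne hφ hc,
        ← mul_assoc, sign_mul_abs]
  · intro e he
    by_cases hne : inner ℝ (outwardNormal T e) u = (0 : ℝ)
    · simp [hne]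
    · have hn := h.isOutwardNormal e he
      exact (integrable_ind_mul (measurableSet_shadow (h.isFlatFace e he)
        hn.inner_vectorSpan hne) hg).const_mul _

/-! ### Polynomials as differentiable functions, and the divergence theorem for them. -/

theorem peval_add (p q : MvPolynomial (Fin d) ℝ) (x : Pt d) :
    peval (p + q) x = peval p x + peval q x := by simp [peval]

theorem peval_sub (p q : MvPolynomial (Fin d) ℝ) (x : Pt d) :
    peval (p - q) x = peval p x - peval q x := by simp [peval]

theorem peval_mul (p q : MvPolynomial (Fin d) ℝ) (x : Pt d) :
    peval (p * q) x = peval p x * peval q x := by simp [peval]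

theorem hasFDerivAt_peval (p : MvPolynomial (Fin d) ℝ) (x : Pt d) :
    HasFDerivAt (peval p) (∑ i, peval (MvPolynomial.pderiv i p) x •
      (EuclideanSpace.proj i : Pt d →L[ℝ] ℝ)) x := by
  induction p using MvPolynomial.induction_on with
  | C a =>
    have : peval (d := d) (MvPolynomial.C a) = fun _ => a := by ext; simp [peval]
    rw [this]
    exact (hasFDerivAt_const a x).congr_fderiv (by simp [peval])
  | add p q hp hq =>
    have : peval (d := d) (p + q) = peval p + peval q := by ext y; simp [peval]
    rw [this]
    refine (hp.add hq).congr_fderiv ?_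
    rw [← Finset.sum_add_distrib]
    refine Finset.sum_congr rfl fun i _ => ?_
    rw [map_add, peval_add, add_smul]
  | mul_X p i hp =>
    have : peval (d := d) (p * MvPolynomial.X i) =
        fun y => peval p y * (EuclideanSpace.proj i : Pt d →L[ℝ] ℝ) y := by
      ext y; simp [peval]
    rw [this]
    refine (hp.mul (EuclideanSpace.proj i : Pt d →L[ℝ] ℝ).hasFDerivAt).congr_fderiv ?_
    have h1 : ∀ j, peval (MvPolynomial.pderiv j (p * MvPolynomial.X i)) x =
        peval p x * (if j = i then 1 else 0) + x i * peval (MvPolynomial.pderiv j p) x := by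
      intro j
      rw [MvPolynomial.pderiv_mul, MvPolynomial.pderiv_X, peval_add, peval_mul, peval_mul]
      by_cases hj : j = i
      · subst hj; simp [peval]; ring
      · simp [peval, hj, Ne.symm hj]; ring
    simp only [h1, add_smul, Finset.sum_add_distrib, Finset.smul_sum, smul_smul]
    simp

theorem contDiff_peval (p : MvPolynomial (Fin d) ℝ) : ContDiff ℝ 1 (peval (d := d) p) := by
  rw [contDiff_one_iff_hasFDerivAt]
  refine ⟨_, ?_, hasFDerivAt_peval p⟩
  exact continuous_finsetSum _ fun i _ => (continuous_peval _).smul continuous_const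

theorem fderiv_peval_single (p : MvPolynomial (Fin d) ℝ) (x : Pt d) (i : Fin d) :
    fderiv ℝ (peval p) x (EuclideanSpace.single i 1) = peval (MvPolynomial.pderiv i p) x := by
  rw [(hasFDerivAt_peval p x).fderiv]
  simp

/-- The divergence theorem on a polytope, for polynomials. -/
theorem IsCell.integral_pderiv {T : Set (Pt d)} {F : Finset (Set (Pt d))} (h : IsCell T F)
    (hd : 1 ≤ d) (p : MvPolynomial (Fin d) ℝ) (i : Fin d) :
    ∫ x in T, peval (MvPolynomial.pderiv i p) x =
      ∑ e ∈ F, outwardNormal T e i * ∫ x : e, peval p x ∂(surface e) := by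
  obtain ⟨R, hR0, hR⟩ := h.isElement.isCompact.isBounded.subset_ball_lt 0 (0 : Pt d)
  -- The cut-off is 1 on an open ball containing `T`, so the product has the values and the
  -- derivatives of the polynomial on all of `T`.
  let ρ : ContDiffBump (0 : Pt d) := ⟨R, R + 1, hR0, by linarith⟩
  have h1 := h.integral_fderiv hd (φ := fun x => ρ x * peval p x)
    (ρ.contDiff.mul (contDiff_peval p)) (ρ.hasCompactSupport.mul_right)
    (EuclideanSpace.single i 1)
  have hρ : ∀ x ∈ T, (fun y => ρ y * peval p y) =ᶠ[𝓝 x] peval p := by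
    intro x hx
    filter_upwards [ρ.eventuallyEq_one_of_mem_ball (hR hx)] with y hy
    rw [hy, Pi.one_apply, one_mul]
  have h2 : ∫ x in T, fderiv ℝ (fun x => ρ x * peval p x) x (EuclideanSpace.single i 1) =
      ∫ x in T, peval (MvPolynomial.pderiv i p) x := by
    refine setIntegral_congr_fun h.isElement.isCompact.measurableSet fun x hx => ?_
    rw [(hρ x hx).fderiv_eq, fderiv_peval_single]
  rw [← h2, h1]
  refine Finset.sum_congr rfl fun e he => ?_
  congr 1
  · simp [EuclideanSpace.inner_single_right]
  · congr 1
    ext x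
    exact (hρ x (h.face_subset_self he x.2)).eq_of_nhds

/-! ### Green's formula -/

/-- The right-hand side `-(p₀, ∇ · q)_T + ⟨p_b, q · n⟩_{∂T}` for polynomials. -/
def residual (T : Set (Pt d)) (F : Finset (Set (Pt d))) (p₀ : MvPolynomial (Fin d) ℝ)
    (pb : Set (Pt d) → MvPolynomial (Fin d) ℝ) (q : Fin d → MvPolynomial (Fin d) ℝ) : ℝ :=
  -(∫ x in T, peval p₀ x * peval (pdiv q) x) +
    ∑ e ∈ F, ∫ x : e, peval (pb e) x * ∑ i, peval (q i) x * outwardNormal T e i ∂(surface e)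

theorem integrable_peval {T : Set (Pt d)} (hT : IsCompact T) (p : MvPolynomial (Fin d) ℝ) :
    IntegrableOn (peval p) T :=
  (continuous_peval p).continuousOn.integrableOn_compact hT

theorem IsFlatFace.integrable {e : Set (Pt d)} (h : IsFlatFace e) {g : Pt d → ℝ}
    (hg : Continuous g) : Integrable (fun x : e => g x) (surface e) := by
  have := isFiniteMeasure_surface h
  exact integrable_of_continuous h.isCompact _ (hg.comp continuous_subtype_val)

theorem continuous_flux (q : Fin d → MvPolynomial (Fin d) ℝ) (n : Pt d) :
    Continuous fun x : Pt d => ∑ i, peval (q i) x * n i :=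
  continuous_finsetSum _ fun i _ => (continuous_peval (q i)).mul continuous_const

/-- The divergence theorem for the products `p₀ q_i` moves the derivative onto `p₀`. In this form
the residual shows the two quantities to be annihilated: the gradient of `p₀`, and the jump `p_b -
p₀` on each face. -/
theorem IsCell.green {T : Set (Pt d)} {F : Finset (Set (Pt d))} (h : IsCell T F) (hd : 1 ≤ d)
    (p₀ : MvPolynomial (Fin d) ℝ) (pb : Set (Pt d) → MvPolynomial (Fin d) ℝ)
    (q : Fin d → MvPolynomial (Fin d) ℝ) :
    residual T F p₀ pb q =
      (∑ i, ∫ x in T, peval (MvPolynomial.pderiv i p₀) x * peval (q i) x) +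
      ∑ e ∈ F, ∫ x : e, peval (pb e - p₀) x *
        ∑ i, peval (q i) x * outwardNormal T e i ∂(surface e) := by
  have hT := h.isElement.isCompact
  have h1 : ∀ i, (∫ x in T, peval (MvPolynomial.pderiv i p₀) x * peval (q i) x) +
      ∫ x in T, peval p₀ x * peval (MvPolynomial.pderiv i (q i)) x =
      ∑ e ∈ F, ∫ x : e, peval p₀ x * (peval (q i) x * outwardNormal T e i) ∂(surface e) := by
    intro i
    have h2 := h.integral_pderiv hd (p₀ * q i) i
    have h3 : ∀ x : Pt d, peval (MvPolynomial.pderiv i (p₀ * q i)) x =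
        peval (MvPolynomial.pderiv i p₀ * q i) x + peval (p₀ * MvPolynomial.pderiv i (q i)) x := by
      intro x
      rw [MvPolynomial.pderiv_mul, peval_add]
    simp only [h3] at h2
    rw [integral_add (integrable_peval hT _) (integrable_peval hT _)] at h2
    simp only [peval_mul] at h2
    rw [h2]
    refine Finset.sum_congr rfl fun e _ => ?_
    rw [← integral_const_mul]
    congr 1
    ext x
    ring
  have h4 : ∫ x in T, peval p₀ x * peval (pdiv q) x =
      ∑ i, ∫ x in T, peval p₀ x * peval (MvPolynomial.pderiv i (q i)) x := by
    rw [← integral_finsetSum]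
    · congr 1
      ext x
      rw [← Finset.mul_sum]
      simp [pdiv, peval]
    · intro i _
      exact (((continuous_peval _).mul (continuous_peval _)).continuousOn.integrableOn_compact hT)
  have h5 : ∑ i, ∑ e ∈ F, ∫ x : e, peval p₀ x * (peval (q i) x * outwardNormal T e i) ∂(surface e) =
      ∑ e ∈ F, ∫ x : e, peval p₀ x * ∑ i, peval (q i) x * outwardNormal T e i ∂(surface e) := by
    rw [Finset.sum_comm]
    refine Finset.sum_congr rfl fun e he => ?_
    rw [← integral_finsetSum]
    · simp only [Finset.mul_sum]
    · intro i _
      exact (h.isFlatFace e he).integrable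
        ((continuous_peval p₀).mul ((continuous_peval (q i)).mul continuous_const))
  have h6 : ∑ e ∈ F, ∫ x : e, peval (pb e - p₀) x *
        ∑ i, peval (q i) x * outwardNormal T e i ∂(surface e) =
      (∑ e ∈ F, ∫ x : e, peval (pb e) x * ∑ i, peval (q i) x * outwardNormal T e i ∂(surface e)) -
      ∑ e ∈ F, ∫ x : e, peval p₀ x * ∑ i, peval (q i) x * outwardNormal T e i ∂(surface e) := by
    rw [← Finset.sum_sub_distrib]
    refine Finset.sum_congr rfl fun e he => ?_
    have hi : ∀ r : MvPolynomial (Fin d) ℝ, Integrable (fun x : e => peval r x *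
        ∑ i, peval (q i) x * outwardNormal T e i) (surface e) := fun r =>
      (h.isFlatFace e he).integrable ((continuous_peval r).mul (continuous_flux q _))
    rw [← integral_sub (hi _) (hi _)]
    congr 1
    ext x
    rw [peval_sub, sub_mul]
  have h7 := Finset.sum_congr (rfl : Finset.univ = (Finset.univ : Finset (Fin d))) fun i _ => h1 i
  rw [Finset.sum_add_distrib, h5, ← h4] at h7
  rw [residual, h6, ← h7]
  ring

/-! ### Vanishing of polynomials and of continuous functions -/

theorem IsElement.eq_zero_of_integral {T : Set (Pt d)} (hT : IsElement T)
    {p : MvPolynomial (Fin d) ℝ} (hp : ∀ x ∈ T, 0 ≤ peval p x) (h : ∫ x in T, peval p x = 0) :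
    p = 0 := by
  have hc := hT.isCompact
  have hcont := continuous_peval p
  have hae := (setIntegral_eq_zero_iff_of_nonneg_ae
    ((ae_restrict_iff' hc.measurableSet).2 (Eventually.of_forall hp)) (integrable_peval hc p)).1 h
  have heq : EqOn (peval p) (fun _ => (0 : ℝ)) (interior T) :=
    Measure.eqOn_open_of_ae_eq (ae_mono (Measure.restrict_mono interior_subset le_rfl) hae)
      isOpen_interior hcont.continuousOn continuousOn_const
  have hcl := heq.closure hcont continuous_const
  rw [hT.regular] at hcl
  refine (injective_iff_map_eq_zero _).1 (evalOn_injective hT) p ?_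
  ext x
  exact hcl x.2

/-- A continuous function that vanishes almost everywhere vanishes on the relative interior, which
is dense in the face. -/
theorem IsFlatFace.eq_zero_of_ae {e : Set (Pt d)} (h : IsFlatFace e) {p : Pt d} (hp : p ∈ e)
    {f : Pt d → ℝ} (hf : Continuous f)
    (hae : ∀ᵐ w ∂(volume.restrict (chart e p ⁻¹' e)), f (chart e p w) = 0) : ∀ x ∈ e, f x = 0 := by
  have heq : EqOn (fun w => f (chart e p w)) (fun _ => (0 : ℝ)) (interior (chart e p ⁻¹' e)) :=
    Measure.eqOn_open_of_ae_eq (ae_mono (Measure.restrict_mono interior_subset le_rfl) hae)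
      isOpen_interior (hf.comp (continuous_chart e p)).continuousOn continuousOn_const
  have h1 : EqOn f (fun _ => (0 : ℝ)) (intrinsicInterior ℝ e) := by
    intro x hx
    obtain ⟨w, rfl⟩ := mem_range_chart hp (intrinsicInterior_subset hx)
    exact heq ((chart_mem_intrinsicInterior_iff hp w).1 hx)
  have hcl := h1.closure hf continuous_const
  rw [h.regular] at hcl
  exact hcl

theorem IsFlatFace.ae_eq_zero_of_integral {e : Set (Pt d)} (h : IsFlatFace e) {p : Pt d}
    (hp : p ∈ e) {f : Pt d → ℝ} (hf : Continuous f) (h0 : ∀ x ∈ e, 0 ≤ f x)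
    (hint : ∫ x : e, f x ∂(surface e) = 0) :
    ∀ᵐ w ∂(volume.restrict (chart e p ⁻¹' e)), f (chart e p w) = 0 := by
  rw [h.integral_surface hp] at hint
  have hc : IsCompact (chart e p ⁻¹' e) :=
    (isometry_chart e p).isClosedEmbedding.isCompact_preimage h.isCompact
  exact (setIntegral_eq_zero_iff_of_nonneg_ae
    ((ae_restrict_iff' hc.measurableSet).2 (Eventually.of_forall fun w hw => h0 _ hw))
    ((hf.comp (continuous_chart e p)).continuousOn.integrableOn_compact hc)).1 hint

theorem IsFlatFace.ae_of_null {e N : Set (Pt d)} (h : IsFlatFace e) {p : Pt d}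
    (hN : volume (chart e p ⁻¹' (e ∩ N)) = 0) :
    ∀ᵐ w ∂(volume.restrict (chart e p ⁻¹' e)), chart e p w ∉ N := by
  rw [ae_restrict_iff' ((continuous_chart e p).measurable h.isCompact.measurableSet), ae_iff]
  refine measure_mono_null (fun w hw => ?_) hN
  simp only [mem_ofPred_eq, Classical.not_imp, not_not] at hw
  exact hw

/-- The exceptional points are the relative boundary and the intersections with the finitely many
other faces, all of surface measure zero. -/
theorem IsCell.ae_generic {T : Set (Pt d)} {F : Finset (Set (Pt d))} (h : IsCell T F)
    {e : Set (Pt d)} (he : e ∈ F) {p : Pt d} (hp : p ∈ e) :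
    ∀ᵐ w ∂(volume.restrict (chart e p ⁻¹' e)), chart e p w ∈ intrinsicInterior ℝ e ∧
      ∀ e' ∈ F, e' ≠ e → chart e p w ∉ e' := by
  have hf := h.isFlatFace e he
  have h1 : ∀ᵐ w ∂(volume.restrict (chart e p ⁻¹' e)), ∀ e' ∈ F, e' ≠ e → chart e p w ∉ e' := by
    rw [Filter.eventually_all_finset]
    intro e' he'
    rw [Filter.eventually_imp_distrib_left]
    intro hne
    exact hf.ae_of_null (hf.null_inter (h.isFlatFace e' he') (h.disjoint_faces e he e' he' hne.symm) hp)
  have h2 : ∀ᵐ w ∂(volume.restrict (chart e p ⁻¹' e)), chart e p w ∉ (intrinsicInterior ℝ e)ᶜ :=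
    hf.ae_of_null (hf.null_boundary hp)
  filter_upwards [h1, h2] with w hw1 hw2
  exact ⟨not_not.1 hw2, hw1⟩

theorem IsFlatFace.restrict_ne_zero {e : Set (Pt d)} (h : IsFlatFace e) {p : Pt d} (hp : p ∈ e) :
    volume.restrict (chart e p ⁻¹' e) ≠ 0 := by
  obtain ⟨x, hx⟩ := h.connected.nonempty
  obtain ⟨w, rfl⟩ := mem_range_chart hp (intrinsicInterior_subset hx)
  have h1 := (chart_mem_intrinsicInterior_iff hp w).1 hx
  rw [Ne, Measure.restrict_eq_zero]
  exact fun h0 => (isOpen_interior.measure_pos volume ⟨w, h1⟩).ne'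
    (measure_mono_null interior_subset h0)

theorem IsCell.exists_generic {T : Set (Pt d)} {F : Finset (Set (Pt d))} (h : IsCell T F)
    {e : Set (Pt d)} (he : e ∈ F) :
    ∃ x ∈ intrinsicInterior ℝ e, ∀ e' ∈ F, e' ≠ e → x ∉ e' := by
  obtain ⟨p, hp⟩ := (h.isFlatFace e he).nonempty
  have := ae_neBot.2 ((h.isFlatFace e he).restrict_ne_zero hp)
  obtain ⟨w, hw⟩ := (h.ae_generic he hp).exists
  exact ⟨_, hw⟩

/-! ### The kernel of the weak gradient on one element -/

theorem peval_eq_of_pderiv_eq_zero {p : MvPolynomial (Fin d) ℝ}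
    (h : ∀ i, MvPolynomial.pderiv i p = 0) (x y : Pt d) : peval p x = peval p y := by
  refine is_const_of_fderiv_eq_zero (𝕜 := ℝ) (fun z => (hasFDerivAt_peval p z).differentiableAt)
    (fun z => ?_) x y
  rw [(hasFDerivAt_peval p z).fderiv]
  simp [h, peval]

/-- Testing with `ω ∇p₀`, where `ω` vanishes on the boundary. -/
theorem IsCell.pderiv_eq_zero {T : Set (Pt d)} {F : Finset (Set (Pt d))} (h : IsCell T F)
    (hd : 1 ≤ d) {p₀ ω : MvPolynomial (Fin d) ℝ} {pb : Set (Pt d) → MvPolynomial (Fin d) ℝ}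
    (hω : ω ≠ 0) (hω0 : ∀ x ∈ T, 0 ≤ peval ω x) (hωF : ∀ e ∈ F, ∀ x ∈ e, peval ω x = 0)
    (hres : residual T F p₀ pb (fun i => ω * MvPolynomial.pderiv i p₀) = 0) (i : Fin d) :
    MvPolynomial.pderiv i p₀ = 0 := by
  rw [h.green hd] at hres
  have h1 : ∑ e ∈ F, ∫ x : e, peval (pb e - p₀) x *
      ∑ i, peval (ω * MvPolynomial.pderiv i p₀) x * outwardNormal T e i ∂(surface e) = 0 := by
    refine Finset.sum_eq_zero fun e he => ?_
    refine (integral_congr_ae (Eventually.of_forall fun x => ?_)).trans (integral_zero _ _)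
    simp [peval_mul, hωF e he x x.2]
  have h2 : ∀ i (x : Pt d), peval (MvPolynomial.pderiv i p₀) x *
      peval (ω * MvPolynomial.pderiv i p₀) x = peval (ω * MvPolynomial.pderiv i p₀ ^ 2) x := by
    intro i x
    simp only [peval, map_mul, map_pow]; ring
  have h3 : ∀ i, ∀ x ∈ T, 0 ≤ peval (ω * MvPolynomial.pderiv i p₀ ^ 2) x := by
    intro i x hx
    rw [peval_mul]
    refine mul_nonneg (hω0 x hx) ?_
    simp only [peval, map_pow]; positivity
  rw [h1, add_zero] at hres
  simp only [h2] at hres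
  have h4 := (Finset.sum_eq_zero_iff_of_nonneg fun i _ =>
    setIntegral_nonneg h.isElement.isCompact.measurableSet (h3 i)).1 hres i (Finset.mem_univ i)
  have h5 := h.isElement.eq_zero_of_integral (h3 i) h4
  exact pow_eq_zero_iff two_ne_zero |>.1 ((mul_eq_zero.1 h5).resolve_left hω)

theorem sum_mul_self_eq_one {n : Pt d} (hn : ‖n‖ = 1) : ∑ i, n i * n i = 1 := by
  have := EuclideanSpace.norm_sq_eq n
  rw [hn] at this
  simpa [sq] using this.symm

/-- Testing with `ω (p_b - p₀) n`, where `ω` vanishes on the other faces. -/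
theorem IsCell.eq_on_face {T : Set (Pt d)} {F : Finset (Set (Pt d))} (h : IsCell T F)
    (hd : 1 ≤ d) {p₀ ω : MvPolynomial (Fin d) ℝ} {pb : Set (Pt d) → MvPolynomial (Fin d) ℝ}
    (hp₀ : ∀ i, MvPolynomial.pderiv i p₀ = 0) {e : Set (Pt d)} (he : e ∈ F)
    (hω0 : ∀ x ∈ e, 0 ≤ peval ω x) (hωF : ∀ e' ∈ F, e' ≠ e → ∀ x ∈ e', peval ω x = 0)
    {p : Pt d} (hp : p ∈ e)
    (hne : ∀ᵐ w ∂(volume.restrict (chart e p ⁻¹' e)), peval ω (chart e p w) ≠ 0)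
    (hres : residual T F p₀ pb
      (fun i => MvPolynomial.C (outwardNormal T e i) * (ω * (pb e - p₀))) = 0) :
    ∀ x ∈ e, peval (pb e - p₀) x = 0 := by
  have hf := h.isFlatFace e he
  rw [h.green hd] at hres
  have h0 : ∀ i, ∫ x in T, peval (MvPolynomial.pderiv i p₀) x *
      peval (MvPolynomial.C (outwardNormal T e i) * (ω * (pb e - p₀))) x = 0 := by
    intro i
    simp [hp₀ i, peval]
  rw [Finset.sum_eq_zero fun i _ => h0 i, zero_add, Finset.sum_eq_single_of_mem e he] at hres
  · have h1 : ∀ x : Pt d, peval (pb e - p₀) x * ∑ i,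
        peval (MvPolynomial.C (outwardNormal T e i) * (ω * (pb e - p₀))) x * outwardNormal T e i =
        peval ω x * peval (pb e - p₀) x ^ 2 := by
      intro x
      have : ∀ i, peval (MvPolynomial.C (outwardNormal T e i) * (ω * (pb e - p₀))) x *
          outwardNormal T e i = (outwardNormal T e i * outwardNormal T e i) *
            (peval ω x * peval (pb e - p₀) x) := by
        intro i
        simp only [peval, map_mul, MvPolynomial.eval_C]; ring
      simp only [this]
      rw [← Finset.sum_mul, sum_mul_self_eq_one (h.isOutwardNormal e he).norm_eq]
      ring
    simp only [h1] at hres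
    refine hf.eq_zero_of_ae hp (continuous_peval _) ?_
    filter_upwards [hne, hf.ae_eq_zero_of_integral hp
      ((continuous_peval ω).mul ((continuous_peval (pb e - p₀)).pow 2))
      (fun x hx => mul_nonneg (hω0 x hx) (sq_nonneg _)) hres] with w hw1 hw2
    exact pow_eq_zero_iff two_ne_zero |>.1 ((mul_eq_zero.1 hw2).resolve_left hw1)
  · intro e' he' hne'
    refine (integral_congr_ae (Eventually.of_forall fun x => ?_)).trans (integral_zero _ _)
    simp [peval_mul, hωF e' he' hne' x x.2]

/-! ### Affine forms of the faces and explicit degrees. -/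

theorem IsFlatFace.mem_affineSpan_iff {T e : Set (Pt d)} (h : IsFlatFace e) {n : Pt d}
    (hn : IsOutwardNormal T e n) {p : Pt d} (hp : p ∈ e) (x : Pt d) :
    x ∈ affineSpan ℝ e ↔ inner ℝ n (p - x) = (0 : ℝ) := by
  have hn0 : n ≠ 0 := by
    intro h0
    have := hn.norm_eq
    rw [h0, norm_zero] at this
    exact zero_ne_one this
  -- The directions of `e` are orthogonal to `n`, and they fill the orthogonal complement because
  -- both have dimension `d - 1`.
  have hW : vectorSpan ℝ e = (Submodule.span ℝ {n})ᗮ := by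
    refine Submodule.eq_of_le_of_finrank_eq (fun w hw => ?_) ?_
    · rw [Submodule.mem_orthogonal_singleton_iff_inner_right]
      exact hn.inner_vectorSpan w hw
    · have h1 := Submodule.finrank_add_finrank_orthogonal (Submodule.span ℝ {n})
      rw [finrank_span_singleton hn0, finrank_euclideanSpace, Fintype.card_fin] at h1
      rw [h.finrank_eq]
      omega
  rw [← AffineSubspace.vsub_right_mem_direction_iff_mem (subset_affineSpan ℝ e hp),
    direction_affineSpan, hW, Submodule.mem_orthogonal_singleton_iff_inner_right, vsub_eq_sub,
    ← neg_sub p x, inner_neg_right, neg_eq_zero]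

/-- The convex polytope `T` lies in the half space given by each of its faces. -/
theorem IsCell.inner_nonneg_of_convex {T : Set (Pt d)} {F : Finset (Set (Pt d))} (h : IsCell T F)
    (hT : Convex ℝ T) {e : Set (Pt d)} (he : e ∈ F) {p : Pt d} (hp : p ∈ e) {y : Pt d}
    (hy : y ∈ T) : (0 : ℝ) ≤ inner ℝ (outwardNormal T e) (p - y) := by
  obtain ⟨x, hx, hoth⟩ := h.exists_generic he
  obtain ⟨ε, hε, hb⟩ := h.local_side he hx hoth
  have hxe := intrinsicInterior_subset hx
  have h1 : inner ℝ (outwardNormal T e) (p - y) = inner ℝ (outwardNormal T e) (x - y) := by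
    have := (h.isOutwardNormal e he).orthogonal p hp x hxe
    rw [inner_sub_right] at this
    rw [inner_sub_right, inner_sub_right]
    linarith
  rw [h1]
  by_contra hneg
  push Not at hneg
  have hc : Continuous fun s : ℝ => x + s • (y - x) := by fun_prop
  have hnear : ∀ᶠ s in 𝓝 (0 : ℝ), x + s • (y - x) ∈ Metric.ball x ε :=
    hc.continuousAt.eventually (Metric.isOpen_ball.mem_nhds (by simpa using hε))
  obtain ⟨s, hs, hs0, hs1⟩ := ((hnear.filter_mono (nhdsWithin_le_nhds (s := Ioi 0))).and
    (Ioo_mem_nhdsGT (zero_lt_one (α := ℝ)))).exists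
  -- A short step from the generic point `x` towards `y` stays in `T` by convexity, yet it would lie
  -- on the outer side of `e`.
  refine (hb _ hs).2 ?_ (hT.add_smul_sub_mem (h.face_subset_self he hxe) hy ⟨hs0.le, hs1.le⟩)
  rw [add_sub_cancel_left, inner_smul_right, ← neg_sub x y, inner_neg_right]
  exact mul_pos hs0 (neg_pos.2 hneg)

/-- The affine function that vanishes on a face. -/
theorem IsCell.exists_form {T : Set (Pt d)} {F : Finset (Set (Pt d))} (h : IsCell T F)
    {e : Set (Pt d)} (he : e ∈ F) :
    ∃ ℓ : MvPolynomial (Fin d) ℝ, ℓ.totalDegree ≤ 1 ∧ ℓ ≠ 0 ∧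
      (∀ x, peval ℓ x = 0 ↔ x ∈ affineSpan ℝ e) ∧ (Convex ℝ T → ∀ x ∈ T, 0 ≤ peval ℓ x) := by
  obtain ⟨p, hp⟩ := (h.isFlatFace e he).nonempty
  have hn := h.isOutwardNormal e he
  set n := outwardNormal T e
  let ℓ : MvPolynomial (Fin d) ℝ :=
    ∑ i, MvPolynomial.C (n i) * (MvPolynomial.C (p i) - MvPolynomial.X i)
  have hℓ : ∀ x, peval ℓ x = inner ℝ n (p - x) := by
    intro x
    simp [ℓ, peval, PiLp.inner_apply, mul_comm]
  refine ⟨ℓ, ?_, ?_, fun x => ?_, fun hT x hx => ?_⟩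
  · refine MvPolynomial.totalDegree_finsetSum_le fun i _ => ?_
    refine (MvPolynomial.totalDegree_mul _ _).trans ?_
    rw [MvPolynomial.totalDegree_C, zero_add]
    refine (MvPolynomial.totalDegree_sub _ _).trans ?_
    simp
  · intro h0
    have h1 := hℓ (p - n)
    rw [h0, sub_sub_cancel, real_inner_self_eq_norm_sq, hn.norm_eq] at h1
    simp [peval] at h1
  · rw [hℓ, (h.isFlatFace e he).mem_affineSpan_iff hn hp]
  · rw [hℓ]
    exact h.inner_nonneg_of_convex hT he hp hx

theorem totalDegree_pderiv_le (p : MvPolynomial (Fin d) ℝ) (i : Fin d) :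
    (MvPolynomial.pderiv i p).totalDegree ≤ p.totalDegree - 1 := by
  rw [MvPolynomial.totalDegree, Finset.sup_le_iff]
  intro m hm
  rw [MvPolynomial.mem_support_iff, MvPolynomial.coeff_pderiv] at hm
  have h1 : m + Finsupp.single i 1 ∈ p.support :=
    MvPolynomial.mem_support_iff.2 (left_ne_zero_of_mul hm)
  have h2 := MvPolynomial.le_totalDegree h1
  rw [Finsupp.sum_add_index' (fun _ => rfl) (fun _ _ _ => rfl), Finsupp.sum_single_index rfl] at h2
  omega

theorem totalDegree_prod_pow_le (F : Finset (Set (Pt d)))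
    {ℓ : Set (Pt d) → MvPolynomial (Fin d) ℝ} (hℓ : ∀ e ∈ F, (ℓ e).totalDegree ≤ 1) (r : ℕ) :
    (∏ e ∈ F, ℓ e ^ r).totalDegree ≤ r * F.card := by
  refine (MvPolynomial.totalDegree_finsetProd _ _).trans ?_
  rw [mul_comm, ← smul_eq_mul]
  refine Finset.sum_le_card_nsmul _ _ _ fun e he => ?_
  refine (MvPolynomial.totalDegree_pow _ _).trans ?_
  simpa using Nat.mul_le_mul_left r (hℓ e he)

/-- `p₀` is constant, and the `p_b` are equal to this constant. -/
def IsConstantPair (F : Finset (Set (Pt d))) (p₀ : MvPolynomial (Fin d) ℝ)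
    (pb : Set (Pt d) → MvPolynomial (Fin d) ℝ) : Prop :=
  ∃ c, (∀ x, peval p₀ x = c) ∧ ∀ e ∈ F, ∀ x ∈ e, peval (pb e) x = c

/-- On polynomials of degree at most `k`, the weak gradient of degree `j` on `T` vanishes only for
constants. -/
def WeakGradInjective (k : ℕ) (T : Set (Pt d)) (F : Finset (Set (Pt d))) (j : ℕ) : Prop :=
  ∀ (p₀ : MvPolynomial (Fin d) ℝ) (pb : Set (Pt d) → MvPolynomial (Fin d) ℝ),
    p₀.totalDegree ≤ k → (∀ e ∈ F, (pb e).totalDegree ≤ k) →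
    (∀ q : Fin d → MvPolynomial (Fin d) ℝ, (∀ i, (q i).totalDegree ≤ j) →
      residual T F p₀ pb q = 0) → IsConstantPair F p₀ pb

theorem isConstantPair_of_sub {F : Finset (Set (Pt d))}
    {p₀ : MvPolynomial (Fin d) ℝ} {pb : Set (Pt d) → MvPolynomial (Fin d) ℝ}
    (hp₀ : ∀ i, MvPolynomial.pderiv i p₀ = 0)
    (h : ∀ e ∈ F, ∀ x ∈ e, peval (pb e - p₀) x = 0) : IsConstantPair F p₀ pb := by
  refine ⟨peval p₀ 0, fun x => peval_eq_of_pderiv_eq_zero hp₀ x 0, fun e he x hx => ?_⟩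
  have := h e he x hx
  rw [peval_sub, sub_eq_zero] at this
  rw [this, peval_eq_of_pderiv_eq_zero hp₀ x 0]

/-- The gradient part of `WeakGradInjective`. -/
theorem IsCell.pderiv_eq_zero_of_le {T : Set (Pt d)} {F : Finset (Set (Pt d))} (h : IsCell T F)
    (hd : 1 ≤ d) {k r j : ℕ} (hk : 1 ≤ k) (hr : 1 ≤ r) (hj : r * F.card + k - 1 ≤ j)
    {ℓ : Set (Pt d) → MvPolynomial (Fin d) ℝ} (hdeg : ∀ e ∈ F, (ℓ e).totalDegree ≤ 1)
    (hne : ∀ e ∈ F, ℓ e ≠ 0) (hzero : ∀ e ∈ F, ∀ x, peval (ℓ e) x = 0 ↔ x ∈ affineSpan ℝ e)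
    (hpos : ∀ e ∈ F, ∀ x ∈ T, 0 ≤ peval (ℓ e) x ^ r)
    {p₀ : MvPolynomial (Fin d) ℝ} {pb : Set (Pt d) → MvPolynomial (Fin d) ℝ}
    (hp₀ : p₀.totalDegree ≤ k)
    (hres : ∀ q : Fin d → MvPolynomial (Fin d) ℝ, (∀ i, (q i).totalDegree ≤ j) →
      residual T F p₀ pb q = 0) (i : Fin d) : MvPolynomial.pderiv i p₀ = 0 := by
  refine h.pderiv_eq_zero hd (ω := ∏ e ∈ F, ℓ e ^ r) (pb := pb)
    (Finset.prod_ne_zero_iff.2 fun e he => pow_ne_zero r (hne e he)) (fun x hx => ?_)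
    (fun e he x hx => ?_) (hres _ fun i => ?_) i
  · simp only [peval, map_prod, map_pow]
    exact Finset.prod_nonneg fun e he => hpos e he x hx
  · simp only [peval, map_prod, map_pow]
    refine Finset.prod_eq_zero he ?_
    have := (hzero e he x).2 (subset_affineSpan ℝ e hx)
    rw [peval] at this
    rw [this, zero_pow (by omega)]
  -- The product of forms contributes `r` per face, and the derivative of `p₀` at most `k - 1`.
  · refine (MvPolynomial.totalDegree_mul _ _).trans ?_
    have h1 := totalDegree_prod_pow_le F hdeg r
    have h2 := totalDegree_pderiv_le p₀ i
    omega

/-- The exponent `r` makes the forms nonnegative on `T`: 1 suffices on convex cells, 2 always works.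
Non-coplanarity makes the product over the other faces nonzero almost everywhere on `e`, so it is an
admissible weight there. -/
theorem IsCell.weakGradInjective_of_pow {T : Set (Pt d)} {F : Finset (Set (Pt d))} (h : IsCell T F)
    (hd : 1 ≤ d) {k r j : ℕ} (hk : 1 ≤ k) (hr : 1 ≤ r) (hj : r * F.card + k - 1 ≤ j)
    (hF : NoCoplanarFaces F)
    {ℓ : Set (Pt d) → MvPolynomial (Fin d) ℝ} (hdeg : ∀ e ∈ F, (ℓ e).totalDegree ≤ 1)
    (hne : ∀ e ∈ F, ℓ e ≠ 0) (hzero : ∀ e ∈ F, ∀ x, peval (ℓ e) x = 0 ↔ x ∈ affineSpan ℝ e)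
    (hpos : ∀ e ∈ F, ∀ x ∈ T, 0 ≤ peval (ℓ e) x ^ r) : WeakGradInjective k T F j := by
  classical
  intro p₀ pb hp₀ hpb hres
  have hgrad := h.pderiv_eq_zero_of_le hd hk hr hj hdeg hne hzero hpos hp₀ hres
  refine isConstantPair_of_sub hgrad fun e he => ?_
  have hf := h.isFlatFace e he
  obtain ⟨p, hp⟩ := hf.nonempty
  have hev : ∀ x : Pt d, peval (∏ e' ∈ F.erase e, ℓ e' ^ r) x =
      ∏ e' ∈ F.erase e, peval (ℓ e') x ^ r := by
    intro x
    simp only [peval, map_prod, map_pow]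
  refine h.eq_on_face hd hgrad he (ω := ∏ e' ∈ F.erase e, ℓ e' ^ r) (fun x hx => ?_)
    (fun e' he' hne' x hx => ?_) hp ?_ (hres _ fun i => ?_)
  · rw [hev]
    exact Finset.prod_nonneg fun e' he' =>
      hpos e' (Finset.mem_of_mem_erase he') x (h.face_subset_self he hx)
  · rw [hev]
    refine Finset.prod_eq_zero (Finset.mem_erase.2 ⟨hne', he'⟩) ?_
    rw [(hzero e' he' x).2 (subset_affineSpan ℝ e' hx), zero_pow (by omega)]
  · have h1 : ∀ᵐ w ∂(volume.restrict (chart e p ⁻¹' e)), ∀ e' ∈ F.erase e,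
        chart e p w ∉ affineSpan ℝ e' := by
      rw [Filter.eventually_all_finset]
      intro e' he'
      refine hf.ae_of_null (N := affineSpan ℝ e') ?_
      have he'F := Finset.mem_of_mem_erase he'
      exact measure_mono_null (preimage_mono inter_subset_right) (hf.null_inter_affineSpan
        (h.isFlatFace e' he'F) (hF e he e' he'F (Finset.ne_of_mem_erase he').symm) hp)
    filter_upwards [h1] with w hw
    rw [hev]
    refine Finset.prod_ne_zero_iff.2 fun e' he' => pow_ne_zero r fun h0 => hw e' he' ?_
    exact (hzero e' (Finset.mem_of_mem_erase he') _).1 h0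
  · refine (MvPolynomial.totalDegree_mul _ _).trans ?_
    rw [MvPolynomial.totalDegree_C, zero_add]
    refine (MvPolynomial.totalDegree_mul _ _).trans ?_
    have h1 := totalDegree_prod_pow_le (F.erase e)
      (fun e' he' => hdeg e' (Finset.mem_of_mem_erase he')) r
    have h2 := (MvPolynomial.totalDegree_sub (pb e) p₀).trans (max_le (hpb e he) hp₀)
    -- The jump has degree `k` rather than `k - 1`, but the missing face saves `r ≥ 1`.
    rw [← Finset.card_erase_add_one he, mul_add, mul_one] at hj
    omega

theorem IsCell.weakGradInjective_of_convex {T : Set (Pt d)} {F : Finset (Set (Pt d))}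
    (h : IsCell T F) (hd : 1 ≤ d) {k j : ℕ} (hk : 1 ≤ k) (hF : NoCoplanarFaces F)
    (hT : Convex ℝ T) (hj : F.card + k - 1 ≤ j) : WeakGradInjective k T F j := by
  choose! ℓ h1 h2 h3 h4 using fun e he => h.exists_form (e := e) he
  exact h.weakGradInjective_of_pow hd hk le_rfl (by rwa [one_mul]) hF h1 h2 h3
    fun e he x hx => by rw [pow_one]; exact h4 e he hT x hx

theorem IsCell.weakGradInjective_of_noCoplanarFaces {T : Set (Pt d)} {F : Finset (Set (Pt d))}
    (h : IsCell T F) (hd : 1 ≤ d) {k j : ℕ} (hk : 1 ≤ k) (hF : NoCoplanarFaces F)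
    (hj : 2 * F.card + k - 1 ≤ j) : WeakGradInjective k T F j := by
  choose! ℓ h1 h2 h3 h4 using fun e he => h.exists_form (e := e) he
  exact h.weakGradInjective_of_pow hd hk one_le_two hj hF h1 h2 h3 fun e he x hx => sq_nonneg _

/-! ### Coplanar faces -/

/-- Polynomials approximate continuous functions on compact sets. -/
theorem exists_peval_near {T : Set (Pt d)} (hT : IsCompact T) {g : Pt d → ℝ} (hg : Continuous g)
    {ε : ℝ} (hε : 0 < ε) : ∃ r : MvPolynomial (Fin d) ℝ, ∀ x ∈ T, |peval r x - g x| < ε := by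
  have := isCompact_iff_compactSpace.1 hT
  let X : Fin d → C(T, ℝ) := fun i => ⟨fun x => (x : Pt d) i, by fun_prop⟩
  let A : Subalgebra ℝ C(T, ℝ) := (MvPolynomial.aeval X).range
  have hev : ∀ (r : MvPolynomial (Fin d) ℝ) (x : T),
      (MvPolynomial.aeval X r : C(T, ℝ)) x = peval r x := by
    intro r x
    induction r using MvPolynomial.induction_on with
    | C a => simp [peval]
    | add p q hp hq => rw [map_add, ContinuousMap.add_apply, hp, hq, peval_add]
    | mul_X p i hp =>
      rw [map_mul, ContinuousMap.mul_apply, hp, peval_mul, MvPolynomial.aeval_X]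
      simp [X, peval]
  have hA : A.SeparatesPoints := by
    intro x y hxy
    have : ∃ i, (x : Pt d) i ≠ (y : Pt d) i := by
      by_contra hcon
      push Not at hcon
      exact hxy (Subtype.ext (PiLp.ext hcon))
    obtain ⟨i, hi⟩ := this
    exact ⟨X i, ⟨X i, ⟨MvPolynomial.X i, by simp⟩, rfl⟩, hi⟩
  obtain ⟨⟨a, r, rfl⟩, ha⟩ :=
    ContinuousMap.exists_mem_subalgebra_near_continuous_of_separatesPoints A hA
      (fun x : T => g x) (hg.comp continuous_subtype_val) ε hε
  refine ⟨r, fun x hx => ?_⟩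
  have := ha ⟨x, hx⟩
  rw [Real.norm_eq_abs] at this
  convert this using 3
  exact (hev r ⟨x, hx⟩).symm

/-- Replacing `g` by a polynomial within `ε` on `T` changes the sum by at most `D ε`, with `D`
independent of `ε`. -/
theorem IsCell.sum_integral_continuous_eq_zero {T : Set (Pt d)} {F : Finset (Set (Pt d))}
    (h : IsCell T F) {a : Set (Pt d) → ℝ} {s : Set (Pt d) → MvPolynomial (Fin d) ℝ}
    (hr : ∀ r : MvPolynomial (Fin d) ℝ,
      ∑ e ∈ F, a e * ∫ x : e, peval (s e) x * peval r x ∂(surface e) = 0)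
    {g : Pt d → ℝ} (hg : Continuous g) :
    ∑ e ∈ F, a e * ∫ x : e, peval (s e) x * g x ∂(surface e) = 0 := by
  set D := ∑ e ∈ F, |a e| * ∫ x : e, |peval (s e) x| ∂(surface e)
  have hbound : ∀ ε > 0, |∑ e ∈ F, a e * ∫ x : e, peval (s e) x * g x ∂(surface e)| ≤ D * ε := by
    intro ε hε
    obtain ⟨r, hrε⟩ := exists_peval_near h.isElement.isCompact hg hε
    rw [← sub_zero (∑ e ∈ F, a e * ∫ x : e, peval (s e) x * g x ∂(surface e)), ← hr r,
      ← Finset.sum_sub_distrib]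
    refine (Finset.abs_sum_le_sum_abs _ _).trans ?_
    rw [Finset.sum_mul]
    refine Finset.sum_le_sum fun e he => ?_
    have hi : ∀ f : Pt d → ℝ, Continuous f →
        Integrable (fun x : e => peval (s e) x * f x) (surface e) := fun f hf =>
      (h.isFlatFace e he).integrable ((continuous_peval (s e)).mul hf)
    rw [← mul_sub, ← integral_sub (hi g hg) (hi _ (continuous_peval r)), abs_mul, mul_assoc,
      ← integral_mul_const]
    refine mul_le_mul_of_nonneg_left ?_ (abs_nonneg _)
    refine (abs_integral_le_integral_abs).trans (integral_mono ?_ ?_ fun x => ?_)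
    · exact ((hi g hg).sub (hi _ (continuous_peval r))).abs
    · exact (h.isFlatFace e he).integrable (((continuous_peval (s e)).abs).mul continuous_const)
    · change |peval (s e) x * g x - peval (s e) x * peval r x| ≤ |peval (s e) x| * ε
      rw [← mul_sub, abs_mul, abs_sub_comm]
      exact mul_le_mul_of_nonneg_left (hrε x (h.face_subset_self he x.2)).le (abs_nonneg _)
  have hD : 0 ≤ D := Finset.sum_nonneg fun e _ =>
    mul_nonneg (abs_nonneg _) (integral_nonneg fun _ => abs_nonneg _)
  by_contra hne
  have hpos := abs_pos.2 hne
  -- With this `ε` the bound is less than half of the absolute value of the sum; `D + 1` avoids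
  -- division by zero.
  have := hbound (|∑ e ∈ F, a e * ∫ x : e, peval (s e) x * g x ∂(surface e)| / (2 * (D + 1)))
    (by positivity)
  rw [mul_div_assoc', le_div_iff₀ (by positivity)] at this
  nlinarith

/-- The constant direction `n_e` times a scalar function is used as test field. After passage to
continuous scalars, these can be concentrated near a point of `e` away from all other faces,
coplanar or not. -/
theorem IsCell.eq_on_faces_of_forall {T : Set (Pt d)} {F : Finset (Set (Pt d))}
    (h : IsCell T F) (hd : 1 ≤ d) {p₀ : MvPolynomial (Fin d) ℝ}
    {pb : Set (Pt d) → MvPolynomial (Fin d) ℝ} (hp₀ : ∀ i, MvPolynomial.pderiv i p₀ = 0)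
    (hres : ∀ q, residual T F p₀ pb q = 0) {e : Set (Pt d)} (he : e ∈ F) :
    ∀ x ∈ e, peval (pb e - p₀) x = 0 := by
  have hf := h.isFlatFace e he
  obtain ⟨p, hp⟩ := hf.nonempty
  have hr : ∀ r : MvPolynomial (Fin d) ℝ,
      ∑ e' ∈ F, (∑ i, outwardNormal T e i * outwardNormal T e' i) *
        ∫ x : e', peval (pb e' - p₀) x * peval r x ∂(surface e') = 0 := by
    intro r
    have h1 := hres fun i => MvPolynomial.C (outwardNormal T e i) * r
    rw [h.green hd, Finset.sum_eq_zero fun i _ => ?_, zero_add] at h1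
    · rw [← h1]
      refine Finset.sum_congr rfl fun e' _ => ?_
      rw [← integral_const_mul]
      congr 1
      ext x
      rw [Finset.sum_mul, Finset.mul_sum]
      refine Finset.sum_congr rfl fun i _ => ?_
      simp only [peval, map_mul, MvPolynomial.eval_C]
      ring
    · simp [hp₀ i, peval]
  refine hf.eq_zero_of_ae hp (continuous_peval _) ?_
  filter_upwards [h.ae_generic he hp] with w hw
  set y := chart e p w
  classical
  have hclosed : IsClosed (⋃ e' ∈ F.erase e, e') :=
    (F.erase e).finite_toSet.isClosed_biUnion fun e' he' =>
      (h.isFlatFace e' (Finset.mem_of_mem_erase he')).isCompact.isClosed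
  have hyc : y ∈ (⋃ e' ∈ F.erase e, e')ᶜ := by
    simp only [mem_compl_iff, mem_iUnion, not_exists]
    exact fun e' he' => hw.2 e' (Finset.mem_of_mem_erase he') (Finset.ne_of_mem_erase he')
  obtain ⟨ε, hε, hb⟩ := Metric.isOpen_iff.1 hclosed.isOpen_compl y hyc
  -- A tent around `y` times the jump: it vanishes on all other faces, and its product with the jump
  -- is nonnegative, so the one remaining integral forces the jump to vanish at `y`.
  let g : Pt d → ℝ := fun x => max 0 (ε - dist x y) * peval (pb e - p₀) x
  have hgc : Continuous g :=
    (continuous_const.max (continuous_const.sub (continuous_id.dist continuous_const))).mul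
      (continuous_peval _)
  have hPg : Continuous fun x => peval (pb e - p₀) x * g x := (continuous_peval _).mul hgc
  have h2 := h.sum_integral_continuous_eq_zero hr hgc
  rw [Finset.sum_eq_single_of_mem e he, sum_mul_self_eq_one (h.isOutwardNormal e he).norm_eq,
    one_mul] at h2
  · have h3 := hf.ae_eq_zero_of_integral hp hPg (fun x _ => ?_) h2
    · have h4 := hf.eq_zero_of_ae hp hPg h3 y
        (intrinsicInterior_subset hw.1)
      simp only [g, dist_self, sub_zero, max_eq_right hε.le] at h4
      have h5 : ε * (peval (pb e - p₀) y * peval (pb e - p₀) y) = 0 := by rw [← h4]; ring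
      exact mul_self_eq_zero.1 ((mul_eq_zero.1 h5).resolve_left hε.ne')
    · have : peval (pb e - p₀) x * g x =
          max 0 (ε - dist x y) * (peval (pb e - p₀) x * peval (pb e - p₀) x) := by
        simp only [g]; ring
      rw [this]
      exact mul_nonneg (le_max_left _ _) (mul_self_nonneg _)
  · intro e' he' hne'
    refine mul_eq_zero_of_right _ ?_
    refine (integral_congr_ae (Eventually.of_forall fun x => ?_)).trans (integral_zero _ _)
    have hx : ε ≤ dist (x : Pt d) y := by
      by_contra hlt
      push Not at hlt
      exact hb (Metric.mem_ball.2 hlt) (mem_biUnion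
        (Finset.mem_coe.2 (Finset.mem_erase.2 ⟨hne', he'⟩)) x.2)
    simp [g, hx]

/-! ### Stabilization of the kernels as the degree grows. -/

theorem IsCell.residual_add {T : Set (Pt d)} {F : Finset (Set (Pt d))} (h : IsCell T F)
    (p₀ p₀' : MvPolynomial (Fin d) ℝ) (pb pb' : Set (Pt d) → MvPolynomial (Fin d) ℝ)
    (q : Fin d → MvPolynomial (Fin d) ℝ) :
    residual T F (p₀ + p₀') (pb + pb') q = residual T F p₀ pb q + residual T F p₀' pb' q := by
  have hI : ∀ r : MvPolynomial (Fin d) ℝ,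
      IntegrableOn (fun x => peval r x * peval (pdiv q) x) T := fun r =>
    ((continuous_peval _).mul (continuous_peval _)).continuousOn.integrableOn_compact
      h.isElement.isCompact
  have h1 : ∫ x in T, peval (p₀ + p₀') x * peval (pdiv q) x =
      (∫ x in T, peval p₀ x * peval (pdiv q) x) + ∫ x in T, peval p₀' x * peval (pdiv q) x := by
    simp only [peval_add, add_mul]
    exact integral_add (hI p₀) (hI p₀')
  unfold residual
  rw [h1, neg_add, add_add_add_comm, ← Finset.sum_add_distrib]
  congr 1
  refine Finset.sum_congr rfl fun e he => ?_
  have hi : ∀ r : MvPolynomial (Fin d) ℝ, Integrable (fun x : e => peval r x *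
      ∑ i, peval (q i) x * outwardNormal T e i) (surface e) := fun r =>
    (h.isFlatFace e he).integrable ((continuous_peval r).mul (continuous_flux q _))
  simp only [Pi.add_apply, peval_add, add_mul]
  exact integral_add (hi _) (hi _)

theorem residual_smul (T : Set (Pt d)) (F : Finset (Set (Pt d))) (c : ℝ)
    (p₀ : MvPolynomial (Fin d) ℝ) (pb : Set (Pt d) → MvPolynomial (Fin d) ℝ)
    (q : Fin d → MvPolynomial (Fin d) ℝ) :
    residual T F (c • p₀) (c • pb) q = c * residual T F p₀ pb q := by
  have hs : ∀ (r : MvPolynomial (Fin d) ℝ) (x : Pt d), peval (c • r) x = c * peval r x := by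
    intro r x
    simp [peval]
  unfold residual
  simp only [Pi.smul_apply, hs, mul_assoc, integral_const_mul, ← Finset.mul_sum]
  ring

theorem residual_congr (T : Set (Pt d)) {F : Finset (Set (Pt d))} (p₀ : MvPolynomial (Fin d) ℝ)
    {pb pb' : Set (Pt d) → MvPolynomial (Fin d) ℝ} (h : ∀ e ∈ F, pb e = pb' e)
    (q : Fin d → MvPolynomial (Fin d) ℝ) : residual T F p₀ pb q = residual T F p₀ pb' q := by
  unfold residual
  congr 1
  exact Finset.sum_congr rfl fun e he => by rw [h e he]

open Classical in
/-- Polynomials on the faces in `F`, extended by zero. -/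
def extendFaces {F : Finset (Set (Pt d))} {k : ℕ}
    (y : F → MvPolynomial.restrictTotalDegree (Fin d) ℝ k) (e : Set (Pt d)) :
    MvPolynomial (Fin d) ℝ :=
  if h : e ∈ F then y ⟨e, h⟩ else 0

/-- The pairs of polynomials of degree `k` whose weak gradient of degree `j` vanishes. -/
def IsCell.weakGradKer {T : Set (Pt d)} {F : Finset (Set (Pt d))} (h : IsCell T F) (k j : ℕ) :
    Submodule ℝ (MvPolynomial.restrictTotalDegree (Fin d) ℝ k ×
      (F → MvPolynomial.restrictTotalDegree (Fin d) ℝ k)) where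
  carrier := {y | ∀ q : Fin d → MvPolynomial (Fin d) ℝ, (∀ i, (q i).totalDegree ≤ j) →
    residual T F y.1 (extendFaces y.2) q = 0}
  zero_mem' := by
    intro q _
    have : extendFaces (0 : F → MvPolynomial.restrictTotalDegree (Fin d) ℝ k) = 0 := by
      ext1 e
      simp [extendFaces]
    simp only [Prod.snd_zero, this]
    simp [residual, peval]
  add_mem' := by
    intro y y' hy hy' q hq
    have : extendFaces (y + y').2 = extendFaces y.2 + extendFaces y'.2 := by
      ext1 e
      by_cases he : e ∈ F <;> simp [extendFaces, he]
    rw [this, Prod.fst_add, Submodule.coe_add, h.residual_add, hy q hq, hy' q hq, add_zero]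
  smul_mem' := by
    intro c y hy q hq
    have : extendFaces (c • y).2 = c • extendFaces y.2 := by
      ext1 e
      by_cases he : e ∈ F <;> simp [extendFaces, he]
    rw [this, Prod.smul_fst, Submodule.coe_smul, residual_smul, hy q hq, mul_zero]

/-- More test fields give a smaller kernel, so the kernels decrease with `j` inside one
finite-dimensional space and become stationary. Beyond that degree, vanishing against degree `j` is
vanishing against every polynomial field. -/
theorem IsCell.exists_residual_stable {T : Set (Pt d)} {F : Finset (Set (Pt d))}
    (h : IsCell T F) (k : ℕ) : ∃ N, ∀ j, N ≤ j →
      ∀ (p₀ : MvPolynomial (Fin d) ℝ) (pb : Set (Pt d) → MvPolynomial (Fin d) ℝ),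
      p₀.totalDegree ≤ k → (∀ e ∈ F, (pb e).totalDegree ≤ k) →
      (∀ q : Fin d → MvPolynomial (Fin d) ℝ, (∀ i, (q i).totalDegree ≤ j) →
        residual T F p₀ pb q = 0) → ∀ q, residual T F p₀ pb q = 0 := by
  let K : ℕ →o (Submodule ℝ (MvPolynomial.restrictTotalDegree (Fin d) ℝ k ×
      (F → MvPolynomial.restrictTotalDegree (Fin d) ℝ k)))ᵒᵈ :=
    { toFun := fun j => OrderDual.toDual (h.weakGradKer k j)
      monotone' := fun j j' hjj' y hy q hq => hy q fun i => (hq i).trans hjj' }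
  obtain ⟨N, hN⟩ := IsArtinian.monotone_stabilizes K
  refine ⟨N, fun j hj p₀ pb hp₀ hpb hres q => ?_⟩
  let y : MvPolynomial.restrictTotalDegree (Fin d) ℝ k ×
      (F → MvPolynomial.restrictTotalDegree (Fin d) ℝ k) :=
    (⟨p₀, (MvPolynomial.mem_restrictTotalDegree _ _ _).2 hp₀⟩,
      fun e => ⟨pb e, (MvPolynomial.mem_restrictTotalDegree _ _ _).2 (hpb e e.2)⟩)
  have hy : ∀ q, residual T F y.1 (extendFaces y.2) q = residual T F p₀ pb q := fun q =>
    residual_congr T p₀ (fun e he => by simp [extendFaces, he, y]) q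
  have hmem : y ∈ h.weakGradKer k j := fun q hq => (hy q).trans (hres q hq)
  obtain ⟨m, hm⟩ : ∃ m, ∀ i, (q i).totalDegree ≤ m :=
    ⟨_, fun i => Finset.le_sup (f := fun i => (q i).totalDegree) (Finset.mem_univ i)⟩
  have hKeq : h.weakGradKer k j = h.weakGradKer k (max j m) :=
    ((hN j hj).symm.trans (hN (max j m) (hj.trans (le_max_left _ _))) :)
  rw [hKeq] at hmem
  rw [← hy]
  exact hmem q fun i => (hm i).trans (le_max_right _ _)

theorem IsCell.exists_weakGradInjective {T : Set (Pt d)} {F : Finset (Set (Pt d))}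
    (h : IsCell T F) (hd : 1 ≤ d) {k : ℕ} (hk : 1 ≤ k) :
    ∃ N, ∀ j, N ≤ j → WeakGradInjective k T F j := by
  obtain ⟨N, hN⟩ := h.exists_residual_stable k
  choose! ℓ h1 h2 h3 h4 using fun e he => h.exists_form (e := e) he
  refine ⟨N, fun j hj p₀ pb hp₀ hpb hres => ?_⟩
  have hall := hN j hj p₀ pb hp₀ hpb hres
  -- All degrees are available as tests now, so the degree needed for squared forms is used here,
  -- whatever `j` is.
  have hgrad := h.pderiv_eq_zero_of_le hd hk one_le_two le_rfl h1 h2 h3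
    (fun e he x hx => sq_nonneg _) hp₀ fun q _ => hall q
  exact isConstantPair_of_sub hgrad fun e he => h.eq_on_faces_of_forall hd hgrad hall he

variable {Ω : Set (Pt d)}

/-! ### Piecewise constant functions on the mesh -/

/-- Inside `Ω` and off the faces the elements form a partition of unity. This replaces any count of
the elements that meet at an interior face. -/
theorem PolytopalMesh.sum_ind_eq_one (M : PolytopalMesh Ω) {y : Pt d} (hy : y ∈ Ω)
    (hfr : ∀ T ∈ M.elements, y ∉ frontier T) : ∑ T ∈ M.elements, ind T y = 1 := by
  have h1 : y ∈ ⋃ T ∈ M.elements, T := by rw [M.cover]; exact subset_closure hy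
  obtain ⟨T, hT, hyT⟩ := mem_iUnion₂.1 h1
  have hint : ∀ T ∈ M.elements, y ∈ T → y ∈ interior T := fun T hT hyT => by
    by_contra hcon
    exact hfr T hT ⟨subset_closure hyT, hcon⟩
  rw [Finset.sum_eq_single_of_mem T hT, ind_of_mem hyT]
  intro T' hT' hne
  refine ind_of_notMem fun hyT' => ?_
  exact (M.disjoint_elements T' hT' T hT hne).le_bot ⟨hint T' hT' hyT', hint T hT hyT⟩

/-- Piecewise constants that agree on both sides of every face and vanish on the boundary of the
domain are zero. -/
theorem PolytopalMesh.eq_zero_of_constant (M : PolytopalMesh Ω) (hΩ : IsOpen Ω) (hd : 1 ≤ d)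
    {c b : Set (Pt d) → ℝ} (hcb : ∀ T ∈ M.elements, ∀ e ∈ M.facesOf T, c T = b e)
    (hb : ∀ e ∈ M.faces, e ⊆ frontier Ω → b e = 0) {T₀ : Set (Pt d)} (hT₀ : T₀ ∈ M.elements) :
    c T₀ = 0 := by
  classical
  let u : Pt d := EuclideanSpace.single ⟨0, hd⟩ 1
  have hu : u ≠ 0 := by
    intro h0
    have := congrArg norm h0
    simp [u] at this
  have hgen : ∀ᵐ x : Pt d, ∀ T ∈ M.elements, ∀ e ∈ M.facesOf T, ∀ t : ℝ, x + t • u ∈ e →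
      inner ℝ (outwardNormal T e) u ≠ (0 : ℝ) ∧
      x + t • u ∈ intrinsicInterior ℝ e ∧ ∀ e' ∈ M.faces, e' ≠ e → x + t • u ∉ e' := by
    rw [Filter.eventually_all_finset]
    intro T hT
    rw [Filter.eventually_all_finset]
    intro e he
    have hn := (M.isCell hT).isOutwardNormal e he
    exact ae_line_generic hd M.isFlatFace M.disjoint_faces (M.mem_facesOf.1 he).1 hn.norm_eq
      hn.inner_vectorSpan u
  have hfr : ∀ᵐ x : Pt d, ∀ T ∈ M.elements, x ∉ frontier T := by
    rw [Filter.eventually_all_finset]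
    exact fun T hT => (M.isCell hT).ae_notMem_frontier
  -- Sets of full measure are dense, so a generic line can be based inside `T₀`.
  obtain ⟨x, hxT, hx, hx0⟩ := (Measure.dense_of_ae (hgen.and hfr)).inter_open_nonempty _
    isOpen_interior (M.isElement T₀ hT₀).connected.nonempty
  have hint : ∀ T ∈ M.elements, x ∈ T → x ∈ interior T := fun T hT hyT => by
    by_contra hcon
    exact hx0 T hT ⟨subset_closure hyT, hcon⟩
  have hiso : ∀ t : ℝ, ∀ᶠ s in 𝓝[≠] t, ∀ T ∈ M.elements, x + s • u ∉ frontier T := by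
    intro t
    rw [Filter.eventually_all_finset]
    intro T hT
    have hall : ∀ᶠ s in 𝓝[≠] t, ∀ e ∈ M.facesOf T, x + s • u ∉ e := by
      rw [Filter.eventually_all_finset]
      intro e he
      by_cases hh : ∃ t' : ℝ, x + t' • u ∈ e
      · obtain ⟨t', ht'⟩ := hh
        have hne : ∀ᶠ s in 𝓝[≠] t, s ≠ t' := by
          by_cases htt : t = t'
          · rw [← htt]; exact self_mem_nhdsWithin
          · exact mem_nhdsWithin_of_mem_nhds (isOpen_ne.mem_nhds htt)
        filter_upwards [hne] with s hs hse
        exact hs (line_hit_unique ((M.isCell hT).isOutwardNormal e he).inner_vectorSpan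
          (hx T hT e he t' ht').1 hse ht')
      · push Not at hh
        exact Eventually.of_forall hh
    filter_upwards [hall] with s hs
    rw [(M.isCell hT).frontier_eq]
    simpa using hs
  let f : ℝ → ℝ := fun s => ∑ T ∈ M.elements, c T * ind T (x + s • u)
  have hjump : ∀ t, HasJump f t 0 := by
    intro t
    by_cases hit : ∃ T ∈ M.elements, ∃ e ∈ M.facesOf T, x + t • u ∈ e
    · obtain ⟨T₁, hT₁, e, he₁, hte⟩ := hit
      have heM := (M.mem_facesOf.1 he₁).1
      obtain ⟨-, hrel, hoth⟩ := hx T₁ hT₁ e he₁ t hte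
      -- The hit point lies on no face but `e`, so exactly the elements that have `e` as a face can
      -- jump there.
      let a : Set (Pt d) → ℝ := fun T =>
        if e ∈ M.facesOf T then (SignType.sign (inner ℝ (outwardNormal T e) u : ℝ) : ℝ) else 0
      have ha : ∀ T ∈ M.elements, HasJump (fun s => ind T (x + s • u)) t (a T) := by
        intro T hT
        by_cases he : e ∈ M.facesOf T
        · have := (M.isCell hT).hasJump_ind he (hx T hT e he t hte).1 hrel
            fun e' he' hne => hoth e' (M.mem_facesOf.1 he').1 hne
          simpa only [a, if_pos he] using this
        · simp only [a, if_neg he]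
          refine hasJump_zero_of_eventually (eventually_ind_line_of_notMem_frontier ?_)
          rw [(M.isCell hT).frontier_eq]
          simp only [mem_iUnion, not_exists]
          intro e' he'
          exact hoth e' (M.mem_facesOf.1 he').1 fun hee => he (hee ▸ he')
      have hsum : HasJump f t (∑ T ∈ M.elements, c T * a T) :=
        HasJump.sum fun T hT => (ha T hT).const_mul (c T)
      have hfac : ∑ T ∈ M.elements, c T * a T = b e * ∑ T ∈ M.elements, a T := by
        rw [Finset.mul_sum]
        refine Finset.sum_congr rfl fun T hT => ?_
        by_cases he : e ∈ M.facesOf T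
        · rw [hcb T hT e he]
        · simp only [a, if_neg he, mul_zero]
      -- On a boundary face the common constant is zero. On an interior face the sum of the jumps is
      -- the jump of `∑ 1_T`, which is 1 on both sides.
      have hzero : b e * ∑ T ∈ M.elements, a T = 0 := by
        rcases M.boundary_or_interior e heM with hbd | hin
        · rw [hb e heM hbd, zero_mul]
        · have hc : Continuous fun s : ℝ => x + s • u := by fun_prop
          have hΩn : ∀ᶠ s in 𝓝 t, x + s • u ∈ Ω :=
            hc.continuousAt.eventually (hΩ.mem_nhds (hin hrel))
          have hone : ∀ᶠ s in 𝓝[≠] t, ∑ T ∈ M.elements, ind T (x + s • u) = 1 := by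
            filter_upwards [hΩn.filter_mono nhdsWithin_le_nhds, hiso t] with s h1 h2
            exact M.sum_ind_eq_one h1 h2
          have h0 : HasJump (fun s => ∑ T ∈ M.elements, ind T (x + s • u)) t 0 := by
            rw [← nhdsLT_sup_nhdsGT, eventually_sup] at hone
            exact ⟨1, 1, hone.1, hone.2, sub_self 1⟩
          rw [(HasJump.sum ha).unique h0, mul_zero]
      rw [← hzero, ← hfac]
      exact hsum
    · push Not at hit
      have : HasJump f t (∑ T ∈ M.elements, c T * 0) := by
        refine HasJump.sum fun T hT => HasJump.const_mul (c T) ?_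
        refine hasJump_zero_of_eventually (eventually_ind_line_of_notMem_frontier ?_)
        rw [(M.isCell hT).frontier_eq]
        simpa using hit T hT
      simpa using this
  have hinf : ∀ᶠ s in atTop, f s = 0 := by
    have h1 : ∀ᶠ s : ℝ in atTop, ∀ T ∈ M.elements, ind T (x + s • u) = 0 :=
      (Filter.eventually_all_finset _).2 fun T hT =>
        eventually_atTop_ind (M.isElement T hT).isCompact x hu
    filter_upwards [h1] with s hs
    exact Finset.sum_eq_zero fun T hT => by rw [hs T hT, mul_zero]
  have hnear : ∀ᶠ s in 𝓝 (0 : ℝ), f s = f 0 := by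
    have h1 : ∀ᶠ s in 𝓝 (0 : ℝ), ∀ T ∈ M.elements,
        ind T (x + s • u) = ind T (x + (0 : ℝ) • u) :=
      (Filter.eventually_all_finset _).2 fun T hT =>
        eventually_ind_line_of_notMem_frontier (by simpa using hx0 T hT)
    filter_upwards [h1] with s hs
    exact Finset.sum_congr rfl fun T hT => by rw [hs T hT]
  have hf0 := eq_zero_of_hasJump_zero hjump hinf (hnear.filter_mono nhdsWithin_le_nhds)
  simp only [f, zero_smul, add_zero] at hf0
  rw [Finset.sum_eq_single_of_mem T₀ hT₀, ind_of_mem (_root_.interior_subset hxT), mul_one] at hf0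
  · exact hf0
  · intro T hT hne
    rw [ind_of_notMem, mul_zero]
    intro hxT'
    exact (M.disjoint_elements T hT T₀ hT₀ hne).le_bot ⟨hint T hT hxT', hxT⟩

/-! ### The bilinear form -/

variable {k : ℕ} (M : PolytopalMesh Ω)

theorem isWeakGradient_weakGrad (j : ℕ) (v : Vh M k) (T : M.elements) :
    IsWeakGradient M j v T (weakGrad M j v T) :=
  (existsUnique_isWeakGradient M j v T).choose_spec.1

theorem weakGrad_eq {j : ℕ} {v : Vh M k} {T : M.elements} {G : Fin d → polyOn j (T : Set (Pt d))}
    (h : IsWeakGradient M j v T G) : weakGrad M j v T = G :=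
  (existsUnique_isWeakGradient M j v T).unique (isWeakGradient_weakGrad M j v T) h

theorem integrable_polyOn_mul {T : Set (Pt d)} (hT : IsCompact T) {f g : T → ℝ}
    (hf : Continuous f) (hg : Continuous g) : Integrable (fun x => f x * g x) (vol T) := by
  have := isFiniteMeasure_vol hT
  exact integrable_of_continuous hT _ (hf.mul hg)

theorem weakGradRHS_add_left (v w : Vh M k) (T : M.elements)
    (q : Fin d → MvPolynomial (Fin d) ℝ) :
    weakGradRHS M (v + w) T q = weakGradRHS M v T q + weakGradRHS M w T q := by
  have hT := (M.isElement T T.2).isCompact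
  have hi : ∀ v : Vh M k, Integrable
      (fun x : (T : Set (Pt d)) => (v.1 T : _ → ℝ) x * peval (pdiv q) x) (vol (T : Set (Pt d))) :=
    fun v => integrable_polyOn_mul hT (continuous_of_mem_polyOn (v.1 T).2)
      ((continuous_peval _).comp continuous_subtype_val)
  have h1 : ∫ x, ((v + w).1 T : _ → ℝ) x * peval (pdiv q) x ∂(vol (T : Set (Pt d))) =
      (∫ x, (v.1 T : _ → ℝ) x * peval (pdiv q) x ∂(vol (T : Set (Pt d)))) +
      ∫ x, (w.1 T : _ → ℝ) x * peval (pdiv q) x ∂(vol (T : Set (Pt d))) := by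
    rw [← integral_add (hi v) (hi w)]
    congr 1
    ext x
    simp [add_mul]
  unfold weakGradRHS
  rw [h1, neg_add, add_add_add_comm, ← Finset.sum_add_distrib]
  congr 1
  refine Finset.sum_congr rfl fun e _ => ?_
  have he := M.isFlatFace e e.2
  have := isFiniteMeasure_surface he
  have hi' : ∀ v : Vh M k, Integrable (fun x : (e : Set (Pt d)) => (v.2 e : _ → ℝ) x *
      ∑ i, peval (q i) x * outwardNormal (T : Set (Pt d)) (e : Set (Pt d)) i)
      (surface (e : Set (Pt d))) := fun v =>
    integrable_of_continuous he.isCompact _ ((continuous_of_mem_polyOn (v.2 e).2).mul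
      ((continuous_flux q _).comp continuous_subtype_val))
  rw [← integral_add (hi' v) (hi' w)]
  congr 1
  ext x
  simp [add_mul]

theorem weakGradRHS_smul_left (c : ℝ) (v : Vh M k) (T : M.elements)
    (q : Fin d → MvPolynomial (Fin d) ℝ) :
    weakGradRHS M (c • v) T q = c * weakGradRHS M v T q := by
  unfold weakGradRHS
  rw [mul_add, Finset.mul_sum, mul_neg, ← integral_const_mul]
  congr 1
  · congr 2
    ext x
    simp [mul_assoc]
  · refine Finset.sum_congr rfl fun e _ => ?_
    rw [← integral_const_mul]
    congr 1
    ext x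
    simp [mul_assoc]

theorem weakGrad_add (j : ℕ) (v w : Vh M k) (T : M.elements) :
    weakGrad M j (v + w) T = weakGrad M j v T + weakGrad M j w T := by
  refine weakGrad_eq M fun q hq => ?_
  have hT := (M.isElement T T.2).isCompact
  rw [weakGradRHS_add_left, ← isWeakGradient_weakGrad M j v T q hq,
    ← isWeakGradient_weakGrad M j w T q hq, ← Finset.sum_add_distrib]
  refine Finset.sum_congr rfl fun i _ => ?_
  rw [← integral_add]
  · congr 1
    ext x
    simp [add_mul]
  · exact integrable_polyOn_mul hT (continuous_of_mem_polyOn (weakGrad M j v T i).2)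
      ((continuous_peval _).comp continuous_subtype_val)
  · exact integrable_polyOn_mul hT (continuous_of_mem_polyOn (weakGrad M j w T i).2)
      ((continuous_peval _).comp continuous_subtype_val)

theorem weakGrad_smul (j : ℕ) (c : ℝ) (v : Vh M k) (T : M.elements) :
    weakGrad M j (c • v) T = c • weakGrad M j v T := by
  refine weakGrad_eq M fun q hq => ?_
  rw [weakGradRHS_smul_left, ← isWeakGradient_weakGrad M j v T q hq, Finset.mul_sum]
  refine Finset.sum_congr rfl fun i _ => ?_
  rw [← integral_const_mul]
  congr 1
  ext x
  simp [mul_assoc]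

theorem integrable_weakGrad_mul (j : ℕ) (u v : Vh M k) (T : M.elements) :
    Integrable (fun x => ∑ i, (weakGrad M j u T i : _ → ℝ) x * (weakGrad M j v T i : _ → ℝ) x)
      (vol (T : Set (Pt d))) :=
  integrable_finsetSum _ fun i _ => integrable_polyOn_mul (M.isElement T T.2).isCompact
    (continuous_of_mem_polyOn (weakGrad M j u T i).2)
    (continuous_of_mem_polyOn (weakGrad M j v T i).2)

/-- The form of the scheme as a bilinear map. -/
def wgBilin (j : Set (Pt d) → ℕ) : Vh M k →ₗ[ℝ] Vh M k →ₗ[ℝ] ℝ :=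
  LinearMap.mk₂ ℝ (wgForm M j)
    (fun u u' v => by
      unfold wgForm
      rw [← Finset.sum_add_distrib]
      refine Finset.sum_congr rfl fun T _ => ?_
      rw [← integral_add (integrable_weakGrad_mul M _ _ _ _) (integrable_weakGrad_mul M _ _ _ _)]
      congr 1
      ext x
      simp [weakGrad_add, add_mul, Finset.sum_add_distrib])
    (fun c u v => by
      unfold wgForm
      rw [smul_eq_mul, Finset.mul_sum]
      refine Finset.sum_congr rfl fun T _ => ?_
      rw [← integral_const_mul]
      congr 1
      ext x
      simp [weakGrad_smul, mul_assoc, Finset.mul_sum])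
    (fun u v v' => by
      unfold wgForm
      rw [← Finset.sum_add_distrib]
      refine Finset.sum_congr rfl fun T _ => ?_
      rw [← integral_add (integrable_weakGrad_mul M _ _ _ _) (integrable_weakGrad_mul M _ _ _ _)]
      congr 1
      ext x
      simp [weakGrad_add, mul_add, Finset.sum_add_distrib])
    (fun c u v => by
      unfold wgForm
      rw [smul_eq_mul, Finset.mul_sum]
      refine Finset.sum_congr rfl fun T _ => ?_
      rw [← integral_const_mul]
      congr 1
      ext x
      simp [weakGrad_smul, mul_left_comm, Finset.mul_sum])

theorem weakGrad_eq_zero_of_wgForm {j : Set (Pt d) → ℕ} {v : Vh M k} (h : wgForm M j v v = 0)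
    (T : M.elements) (i : Fin d) : weakGrad M (j T) v T i = 0 := by
  unfold wgForm at h
  have h1 := (Finset.sum_eq_zero_iff_of_nonneg fun T _ =>
    integral_nonneg fun x => Finset.sum_nonneg fun i _ => mul_self_nonneg _).1 h T (Finset.mem_univ T)
  rw [integral_finsetSum] at h1
  · choose g hg hgG using fun i => (weakGrad M (j T) v T i).2
    have h2 : ∑ i, ∫ x, peval (g i) x * peval (g i) x ∂(vol (T : Set (Pt d))) = 0 := by
      rw [← h1]
      refine Finset.sum_congr rfl fun i _ => ?_
      rw [← hgG i]
      rfl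
    exact Subtype.ext ((hgG i).symm.trans (eq_zero_of_integral_sq (M.isElement T T.2) g h2 i))
  · exact fun i _ => integrable_polyOn_mul (M.isElement T T.2).isCompact
      (continuous_of_mem_polyOn (weakGrad M (j T) v T i).2)
      (continuous_of_mem_polyOn (weakGrad M (j T) v T i).2)

/-- Any polynomial representatives will do: on a face they are not unique, but the residual depends
on their restrictions only. -/
theorem weakGradRHS_eq_residual {v : Vh M k} {T : M.elements} {p₀ : MvPolynomial (Fin d) ℝ}
    {pb : Set (Pt d) → MvPolynomial (Fin d) ℝ} (h₀ : evalOn (T : Set (Pt d)) p₀ = v.1 T)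
    (hb : ∀ e : M.faces, evalOn (e : Set (Pt d)) (pb e) = v.2 e)
    (q : Fin d → MvPolynomial (Fin d) ℝ) :
    weakGradRHS M v T q = residual T (M.facesOf T) p₀ pb q := by
  classical
  unfold weakGradRHS residual
  congr 1
  · rw [← h₀]
    have := integral_subtype_comap (μ := volume) (M.isElement T T.2).isCompact.measurableSet
      (fun x => peval p₀ x * peval (pdiv q) x)
    rw [← this]
    rfl
  · have h1 : M.facesOf T = (Finset.univ.filter
        (fun e : M.faces => (e : Set (Pt d)) ⊆ frontier (T : Set (Pt d)))).map
          (Function.Embedding.subtype _) := by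
      ext e
      simp [M.mem_facesOf, and_comm]
    rw [h1, Finset.sum_map]
    refine Finset.sum_congr (by congr) fun e _ => ?_
    rw [← hb e]
    rfl

/-- The form of the scheme is definite on `V_h^0`. -/
theorem eq_zero_of_wgForm (hΩ : IsOpen Ω) (hd : 1 ≤ d) {j : Set (Pt d) → ℕ}
    (hj : ∀ T ∈ M.elements, WeakGradInjective k T (M.facesOf T) (j T)) {v : Vh M k}
    (hv : v ∈ Vh0 M k) (h : wgForm M j v v = 0) : v = 0 := by
  classical
  choose p₀ hp₀ hp₀v using fun T : M.elements => (v.1 T).2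
  choose pb hpb hpbv using fun e : M.faces => (v.2 e).2
  let b : Set (Pt d) → MvPolynomial (Fin d) ℝ := fun e => if he : e ∈ M.faces then pb ⟨e, he⟩ else 0
  have hb : ∀ e : M.faces, b e = pb e := fun e => by simp [b]
  have hconst : ∀ T : M.elements, IsConstantPair (M.facesOf T) (p₀ T) b := by
    intro T
    refine hj T T.2 (p₀ T) b ((MvPolynomial.mem_restrictTotalDegree _ _ _).1 (hp₀ T))
      (fun e he => ?_) (fun q hq => ?_)
    · have := (MvPolynomial.mem_restrictTotalDegree _ _ _).1 (hpb ⟨e, (M.mem_facesOf.1 he).1⟩)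
      rwa [← hb] at this
    · rw [← weakGradRHS_eq_residual M (v := v) (hp₀v T) (fun e => by rw [hb]; exact hpbv e),
        ← isWeakGradient_weakGrad M (j T) v T q
          (fun i => (MvPolynomial.mem_restrictTotalDegree _ _ _).2 (hq i))]
      refine Finset.sum_eq_zero fun i _ => ?_
      rw [weakGrad_eq_zero_of_wgForm M h T i]
      simp
  choose c hc0 hcb using hconst
  -- One point per face, at which the constant carried by the face is read off.
  choose! y hy using fun (e : Set (Pt d)) (he : e ∈ M.faces) => (M.isFlatFace e he).nonempty
  let c' : Set (Pt d) → ℝ := fun T => if hT : T ∈ M.elements then c ⟨T, hT⟩ else 0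
  have hc' : ∀ T : M.elements, c' T = c T := fun T => by simp [c']
  have hzero : ∀ T : M.elements, c T = 0 := by
    intro T
    rw [← hc']
    refine M.eq_zero_of_constant hΩ hd (b := fun e => peval (b e) (y e)) (fun T hT e he => ?_)
      (fun e he heΩ => ?_) T.2
    · rw [hc' ⟨T, hT⟩]
      exact (hcb ⟨T, hT⟩ e he _ (hy e (M.mem_facesOf.1 he).1)).symm
    · have h1 := hv ⟨e, he⟩ heΩ
      have h2 := hpbv ⟨e, he⟩
      rw [h1, ← hb] at h2
      exact congrFun h2 ⟨y e, hy e he⟩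
  refine Prod.ext (funext fun T => ?_) (funext fun e => ?_)
  · refine Subtype.ext ?_
    rw [← hp₀v T]
    ext x
    exact (hc0 T x).trans (hzero T)
  · refine Subtype.ext ?_
    obtain ⟨T, hT, heT⟩ := M.exists_element e e.2
    rw [← hpbv e, ← hb e]
    ext x
    exact (hcb ⟨T, hT⟩ e (M.mem_facesOf.2 ⟨e.2, heT⟩) x x.2).trans (hzero ⟨T, hT⟩)

/-! ### Well-posedness -/

/-- Only the interior of `T` is known to lie in `Ω`. The frontier of `T` is null, so `f` is square
integrable on `T` as well, and the polynomial is bounded there. -/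
theorem integrable_load {f : Pt d → ℝ} (hf : MemLp f 2 (volume.restrict Ω)) (T : M.elements)
    {g : ↥(T : Set (Pt d)) → ℝ} (hg : g ∈ polyOn k (T : Set (Pt d))) :
    Integrable (fun x : ↥(T : Set (Pt d)) => f x * g x) (vol (T : Set (Pt d))) := by
  obtain ⟨p, -, rfl⟩ := hg
  have hT := (M.isElement T T.2).isCompact
  have hfr : volume (frontier (T : Set (Pt d))) = 0 := by
    have := (M.isCell T.2).ae_notMem_frontier
    rw [ae_iff] at this
    simpa using this
  have hfT : MemLp f 2 (volume.restrict (T : Set (Pt d))) := by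
    have h1 := hf.mono_measure (Measure.restrict_mono (M.interior_subset T T.2) le_rfl)
    rwa [Measure.restrict_congr_set (interior_ae_eq_of_null_frontier hfr)] at h1
  have : IsFiniteMeasure (volume.restrict (T : Set (Pt d))) := ⟨by simpa using hT.measure_lt_top⟩
  have hp : MemLp (peval p) 2 (volume.restrict (T : Set (Pt d))) := by
    obtain ⟨C, hC⟩ := hT.exists_bound_of_continuousOn (continuous_peval p).continuousOn
    exact MemLp.of_bound (continuous_peval p).aestronglyMeasurable C
      ((ae_restrict_iff' hT.measurableSet).2 (Eventually.of_forall hC))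
  have h2 : Integrable (fun x => f x * peval p x) (volume.restrict (T : Set (Pt d))) :=
    hfT.integrable_mul hp
  have h3 := (MeasurableEmbedding.subtype_coe hT.measurableSet).integrable_map_iff
    (μ := vol (T : Set (Pt d))) (g := fun x => f x * peval p x)
  unfold vol at h3
  rw [(MeasurableEmbedding.subtype_coe hT.measurableSet).map_comap, Subtype.range_coe] at h3
  exact h3.1 h2

/-- The load as a linear functional. -/
def wgLoadLinear {f : Pt d → ℝ} (hf : MemLp f 2 (volume.restrict Ω)) : Vh M k →ₗ[ℝ] ℝ where
  toFun := wgLoad M f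
  map_add' := by
    intro v w
    unfold wgLoad
    rw [← Finset.sum_add_distrib]
    refine Finset.sum_congr rfl fun T _ => ?_
    rw [← integral_add (integrable_load M hf T (v.1 T).2) (integrable_load M hf T (w.1 T).2)]
    congr 1
    ext x
    simp [mul_add]
  map_smul' := by
    intro c v
    unfold wgLoad
    rw [RingHom.id_apply, smul_eq_mul, Finset.mul_sum]
    refine Finset.sum_congr rfl fun T _ => ?_
    rw [← integral_const_mul]
    congr 1
    ext x
    simp [mul_left_comm]

theorem finiteDimensional_polyOn (k : ℕ) (S : Set (Pt d)) : FiniteDimensional ℝ (polyOn k S) := by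
  unfold polyOn
  infer_instance

/-- A bilinear form that is definite on `W` represents every functional on `W` uniquely. -/
theorem existsUnique_of_definite {V : Type*} [AddCommGroup V] [Module ℝ V] [FiniteDimensional ℝ V]
    (W : Submodule ℝ V) (B : V →ₗ[ℝ] V →ₗ[ℝ] ℝ) (hB : ∀ v ∈ W, B v v = 0 → v = 0)
    (L : V →ₗ[ℝ] ℝ) : ∃! u, u ∈ W ∧ ∀ v ∈ W, B u v = L v := by
  let B' : W →ₗ[ℝ] W →ₗ[ℝ] ℝ := B.domRestrict₁₂ W W
  have hinj : Function.Injective B' := by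
    refine (injective_iff_map_eq_zero _).2 fun v hv => ?_
    exact Subtype.ext (hB v v.2 (LinearMap.congr_fun hv v))
  have hsurj : Function.Surjective B' :=
    (LinearMap.injective_iff_surjective_of_finrank_eq_finrank
      (Subspace.dual_finrank_eq (K := ℝ) (V := W)).symm).1 hinj
  obtain ⟨u, hu⟩ := hsurj (L.domRestrict W)
  refine ⟨u, ⟨u.2, fun v hv => LinearMap.congr_fun hu ⟨v, hv⟩⟩, fun w hw => ?_⟩
  have : B' ⟨w, hw.1⟩ = B' u := by
    rw [hu]
    exact LinearMap.ext fun v => hw.2 v v.2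
  exact congrArg Subtype.val (hinj this)

theorem existsUnique_isWGSolution (hΩ : IsOpen Ω) (hd : 1 ≤ d) {j : Set (Pt d) → ℕ}
    (hj : ∀ T ∈ M.elements, WeakGradInjective k T (M.facesOf T) (j T)) {f : Pt d → ℝ}
    (hf : MemLp f 2 (volume.restrict Ω)) : ∃! u : Vh M k, IsWGSolution M j f u := by
  have := fun S : Set (Pt d) => finiteDimensional_polyOn k S
  exact existsUnique_of_definite (V := Vh M k) (Vh0 M k) (wgBilin M j)
    (fun v hv h => eq_zero_of_wgForm M hΩ hd hj hv h) (wgLoadLinear M hf)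

open Classical in
/-- The degree from which on the weak gradient on `T` vanishes for constants only. -/
def minDegree (k : ℕ) (T : Set (Pt d)) (F : Finset (Set (Pt d))) : ℕ :=
  if NoCoplanarFaces F then
    if Convex ℝ T then F.card + k - 1 else 2 * F.card + k - 1
  -- For cells such an `N` exists by `IsCell.exists_weakGradInjective`; the value 0 serves only
  -- pairs that are not cells.
  else if h : ∃ N, ∀ j, N ≤ j → WeakGradInjective k T F j then h.choose else 0

theorem IsCell.weakGradInjective_of_minDegree_le {T : Set (Pt d)} {F : Finset (Set (Pt d))}
    (h : IsCell T F) (hd : 1 ≤ d) {k j : ℕ} (hk : 1 ≤ k) (hj : minDegree k T F ≤ j) :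
    WeakGradInjective k T F j := by
  unfold minDegree at hj
  split_ifs at hj with hF hT hN
  · exact h.weakGradInjective_of_convex hd hk hF hT hj
  · exact h.weakGradInjective_of_noCoplanarFaces hd hk hF hj
  · exact hN.choose_spec j hj
  · exact absurd (h.exists_weakGradInjective hd hk) hN

end WG
end

theorem lemma3p2 {d : ℕ} (hd : 2 ≤ d) (k : ℕ) (hk : 1 ≤ k) :
    ∃ j₀ : Set (WG.Pt d) → Finset (Set (WG.Pt d)) → ℕ,
      (∀ (T : Set (WG.Pt d)) (F : Finset (Set (WG.Pt d))), WG.NoCoplanarFaces F →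
        (Convex ℝ T → j₀ T F ≤ F.card + k - 1) ∧ j₀ T F ≤ 2 * F.card + k - 1) ∧
      ∀ (Ω : Set (WG.Pt d)), IsOpen Ω → ∀ (M : WG.PolytopalMesh Ω) (j : Set (WG.Pt d) → ℕ),
        (∀ T ∈ M.elements, j₀ T (M.facesOf T) ≤ j T) →
        ∀ f : WG.Pt d → ℝ, MemLp f 2 (volume.restrict Ω) →
          ∃! u : WG.Vh M k, WG.IsWGSolution M j f u := by
  refine ⟨WG.minDegree k, fun T F hF => ?_, fun Ω hΩ M j hj f hf => ?_⟩
  · unfold WG.minDegree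
    rw [if_pos hF]
    split_ifs with hT
    · exact ⟨fun _ => le_rfl, by omega⟩
    · exact ⟨fun h => absurd h hT, le_rfl⟩
  · exact WG.existsUnique_isWGSolution M hΩ (by omega)
      (fun T hT => (M.isCell hT).weakGradInjective_of_minDegree_le (by omega) hk (hj T hT)) hf
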